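/- Let $n\ge 1$ and let $f_0,f_1,f_2$ be real analytic vector fields on $\mathbb{R}^n$ with $f_0(0)=0$, $f_2(0)=0$ and $f_1(0)\neq 0$. Consider the control system $$\dot z=f_0(z)+u_1f_1(z)+u_2f_2(z),\qquad z\in\mathbb{R}^n,\ u=(u_1,u_2)\in\mathbb{R}^2 .$$ Fix any norm $|\cdot|$ on $\mathbb{R}^2$, and let $\|\cdot\|_{L^\infty([0,T],\mathbb{R}^2)}$ be the corresponding $L^\infty$ norm. For $\alpha\ge 0$, the system is called $\alpha$-STLC at $(0,u^{\mathrm{eq}})$ if for every $\varepsilon>0$ there is $\eta>0$ such that for all $z_0,z_1$ in the open Euclidean ball $B(0,\eta)$ there exist a control $u\in L^\infty([0,\varepsilon],\mathbb{R}^2)$ and a (Carathéodory) solution $z:[0,\varepsilon]\to\mathbb{R}^n$ of the system with $z(0)=z_0$, $z(\varepsilon)=z_1$ and $\|u-u^{\mathrm{eq}}\|_{L^\infty([0,\varepsilon],\mathbb{R}^2)}\le\alpha+\varepsilon$. It is called STLC at $(0,u^{\mathrm{eq}})$ if the same holds with $\|u-u^{\mathrm{eq}}\|_{L^\infty([0,\varepsilon],\mathbb{R}^2)}\le\varepsilon$.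 Let $[V,W]=DW\cdot V-DV\cdot W$ be the Lie bracket, let $R_1$ be the real vector space spanned by all iterated Lie brackets of $f_0,f_1,f_2$ (including $f_0,f_1,f_2$ themselves) that contain $f_1$ at most once, and let $R_1(0)=\{g(0):g\in R_1\}\subset\mathbb{R}^n$. Put $B_1=[f_1,[f_0,f_1]]$ and assume $B_1(0)\notin R_1(0)$. 1. If $\beta\in\mathbb{R}$ satisfies $B_1(0)+\beta\,[f_1,[f_2,f_1]](0)\in R_1(0)$, then for every $u_2^{\mathrm{eq}}\in\mathbb{R}$ with $u_2^{\mathrm{eq}}\neq\beta$ the system is not STLC at $(0,(0,u_2^{\mathrm{eq}}))$. 2. If $B_1(0)\notin R_1(0)+\mathrm{Span}([f_1,[f_2,f_1]](0))$, then for every $u_2^{\mathrm{eq}}\in\mathbb{R}$ and every $\alpha\ge 0$ the system is not $\alpha$-STLC at $(0,(0,u_2^{\mathrm{eq}}))$. -/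

import Mathlib

open MeasureTheory VectorField
open scoped ENNReal

namespace ControlAffine

/-- The state space `ℝⁿ` with its Euclidean norm. -/
abbrev State (n : ℕ) : Type := EuclideanSpace ℝ (Fin n)

/-- `z` is a (Carathéodory) solution on `[0, T]` of
`z' = f₀(z) + ∑ k, u k * f k (z)` driven by the control `u`. -/
structure IsSolution {n m : ℕ} (f₀ : State n → State n) (f : Fin m → State n → State n)
    (T : ℝ) (u : ℝ → Fin m → ℝ) (z : ℝ → State n) : Prop where
  continuousOn : ContinuousOn z (Set.Icc 0 T)
  integrableOn : IntegrableOn (fun s => f₀ (z s) + ∑ k, u s k • f k (z s)) (Set.Icc 0 T)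
  eq_integral : ∀ t ∈ Set.Icc 0 T,
    z t = z 0 + ∫ s in (0 : ℝ)..t, (f₀ (z s) + ∑ k, u s k • f k (z s))

/-- The `L^∞([0, T], ℝᵐ)` norm of `w`, where `ℝᵐ` carries the norm `N`. -/
noncomputable def supNorm {m : ℕ} (N : Seminorm ℝ (Fin m → ℝ)) (T : ℝ)
    (w : ℝ → Fin m → ℝ) : ℝ≥0∞ :=
  essSup (fun t => ENNReal.ofReal (N (w t))) (volume.restrict (Set.Icc 0 T))

/-- Some control in `L^∞([0, T], ℝᵐ)` at `L^∞` distance at most `r` from the constant `ueq`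
steers the system from `z₀` to `z₁` in time `T`. -/
def CanSteer {n m : ℕ} (f₀ : State n → State n) (f : Fin m → State n → State n)
    (N : Seminorm ℝ (Fin m → ℝ)) (ueq : Fin m → ℝ) (T r : ℝ) (z₀ z₁ : State n) : Prop :=
  ∃ (u : ℝ → Fin m → ℝ) (z : ℝ → State n),
    MemLp u ∞ (volume.restrict (Set.Icc 0 T)) ∧
    IsSolution f₀ f T u z ∧ z 0 = z₀ ∧ z T = z₁ ∧
    supNorm N T (fun t => u t - ueq) ≤ ENNReal.ofReal r

/-- Small-time local controllability at `(zeq, ueq)`. -/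
def STLC {n m : ℕ} (f₀ : State n → State n) (f : Fin m → State n → State n)
    (N : Seminorm ℝ (Fin m → ℝ)) (zeq : State n) (ueq : Fin m → ℝ) : Prop :=
  ∀ ε : ℝ, 0 < ε → ∃ η : ℝ, 0 < η ∧
    ∀ z₀ ∈ Metric.ball zeq η, ∀ z₁ ∈ Metric.ball zeq η, CanSteer f₀ f N ueq ε ε z₀ z₁

/-- `α`-small-time local controllability at `(zeq, ueq)`. -/
def AlphaSTLC {n m : ℕ} (f₀ : State n → State n) (f : Fin m → State n → State n)
    (N : Seminorm ℝ (Fin m → ℝ)) (α : ℝ) (zeq : State n) (ueq : Fin m → ℝ) : Prop :=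
  ∀ ε : ℝ, 0 < ε → ∃ η : ℝ, 0 < η ∧
    ∀ z₀ ∈ Metric.ball zeq η, ∀ z₁ ∈ Metric.ball zeq η, CanSteer f₀ f N ueq ε (α + ε) z₀ z₁

/-- `IsBracket f₀ f₁ f₂ k V`: the vector field `V` is an iterated Lie bracket of `f₀`, `f₁`, `f₂`
in which `f₁` occurs exactly `k` times. -/
inductive IsBracket {n : ℕ} (f₀ f₁ f₂ : State n → State n) : ℕ → (State n → State n) → Prop
  | base₀ : IsBracket f₀ f₁ f₂ 0 f₀
  | base₁ : IsBracket f₀ f₁ f₂ 1 f₁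
  | base₂ : IsBracket f₀ f₁ f₂ 0 f₂
  | bracket {k l : ℕ} {V W : State n → State n} :
      IsBracket f₀ f₁ f₂ k V → IsBracket f₀ f₁ f₂ l W →
      IsBracket f₀ f₁ f₂ (k + l) (lieBracket ℝ V W)

/-- The space `R₁` of vector fields spanned by the iterated Lie brackets of `f₀`, `f₁`, `f₂`
that contain `f₁` at most once. -/
def R₁ {n : ℕ} (f₀ f₁ f₂ : State n → State n) : Submodule ℝ (State n → State n) :=
  Submodule.span ℝ {V | ∃ k ≤ 1, IsBracket f₀ f₁ f₂ k V}

/-- The subspace `R₁(0)` of `ℝⁿ` formed by the values at `0` of the elements of `R₁`. -/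
def R₁AtZero {n : ℕ} (f₀ f₁ f₂ : State n → State n) : Submodule ℝ (State n) :=
  (R₁ f₀ f₁ f₂).map (LinearMap.proj (0 : State n))

end ControlAffine

/-!
Write `z' = g(z) + w f₁(z)` with `g = f₀ + v f₂`, where `w`, `v` are the two controls, and let `s` be
the primitive of `w` vanishing at time `0`. Only trajectories issued from the origin matter: it is
shown that in small time their end points avoid part of every neighbourhood of the origin.

Moving the state along the flow of `-f₁` for the time `s` removes the term `w f₁(z)`. Since `w` is
bounded, the Taylor polynomial of degree three of that flow (`straighten`) is enough: the error it
leaves in the velocity is `O(s³)`. The straightened state `x` satisfies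

  `φ(x') = φ(A x) - (s² / 2) φ([f₁, [g, f₁]](0)) + remainder`,  `A = Dg(0)`,

for every linear functional `φ` that vanishes on `R₁(0)`
(`SmallFamily.map_straightenVel_add_quadCoeff_isBigO`). As `f₀` and `f₂` vanish at `0`, the
bracket of `fᵢ` with a field `V` has value `-Dfᵢ(0) V(0)` at `0`, so `R₁(0)` is a subspace
containing `f₁(0)` and invariant under `Df₀(0)` and `Df₂(0)` (`fderiv_mem_R₁AtZero`). Hence
`φ(A x)` only sees the class of `x` modulo `R₁(0)`, which itself is of second order. With `J` and `I`
the integrals of `|s|` and `s²` over `[0, T]`, one gets `x = O(J)`, the class of `x` modulo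
`R₁(0)` is `O(I)`, and `J² ≤ T I`, so that all remainders integrate to `O(T I)`. If `φ` is at most
`-1/2` on `[f₁, [g, f₁]](0)` for all admissible values of `v`, then `φ(x(T)) ≥ (1/4 - O(T)) I`
(`IsTrajectory.integral_sq_le`).

Finally `s(T)` is bounded by `O(|z(T)| + J)`, because `f₁(0) ≠ 0`, so passing from `x(T)` back to
`z(T)` costs `O(|z(T)|² + T I)`, and `φ(z(T)) ≥ -D |z(T)|²` for small `T`
(`IsTrajectory.eventually_nonneg`). Points `τ e` with `φ(e) < 0` and `τ > 0` small violate this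
inequality.

A functional `φ` with these properties exists in both cases. When
`B₁(0) + β [f₁, [f₂, f₁]](0) ∈ R₁(0)` and `u₂ᵉ ≠ β`, the vector `B₁(0) + u₂ᵉ [f₁, [f₂, f₁]](0)` is not
in `R₁(0)`, so `φ` can be `-1` on it, and remains negative for `v` close to `u₂ᵉ`. In the other case `φ`
may also be chosen to vanish on `[f₁, [f₂, f₁]](0)`, and then the value of `v` is irrelevant.
-/

namespace ControlAffine

open Asymptotics Filter Topology Set

/-! ### Taylor expansions at the origin -/

section Expansions

variable {E F : Type*} [NormedAddCommGroup E] [NormedSpace ℝ E]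
  [NormedAddCommGroup F] [NormedSpace ℝ F]

/-- A function vanishing at `0` gains one order over its derivative. -/
theorem isBigO_pow_succ_of_fderiv {R : E → F} {k : ℕ} (hR : Differentiable ℝ R) (h0 : R 0 = 0)
    (h : (fun z => fderiv ℝ R z) =O[𝓝 0] fun z => ‖z‖ ^ k) :
    R =O[𝓝 0] fun z => ‖z‖ ^ (k + 1) := by
  obtain ⟨c, hc0, hc⟩ := h.exists_nonneg
  rw [IsBigOWith, Metric.eventually_nhds_iff_ball] at hc
  obtain ⟨ε, hε, hball⟩ := hc
  refine IsBigO.of_bound c ?_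
  filter_upwards [Metric.ball_mem_nhds (0 : E) hε] with z hz
  have hz' : ‖z‖ < ε := by simpa using hz
  have hb : ∀ y ∈ Metric.closedBall (0 : E) ‖z‖, ‖fderiv ℝ R y‖ ≤ c * ‖z‖ ^ k := by
    intro y hy
    have hy' : ‖y‖ ≤ ‖z‖ := by simpa using hy
    have := hball y (by simpa using hy'.trans_lt hz')
    simp only [norm_pow, norm_norm] at this
    exact this.trans (by gcongr)
  have := (convex_closedBall (0 : E) ‖z‖).norm_image_sub_le_of_norm_fderiv_le
    (fun y _ => hR y) hb (x := 0) (y := z) (by simp) (by simp)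
  simpa [h0, pow_succ, mul_assoc] using this

theorem isBigO_sub_apply_zero {f : E → F} (hf : ContDiff ℝ (⊤ : ℕ∞) f) :
    (fun z => f z - f 0) =O[𝓝 0] fun z => ‖z‖ := by
  simpa using ((hf.differentiable (by simp)) 0).isBigO_sub.norm_right

theorem contDiff_fderiv {f : E → F} (hf : ContDiff ℝ (⊤ : ℕ∞) f) :
    ContDiff ℝ (⊤ : ℕ∞) (fderiv ℝ f) :=
  hf.fderiv_right (by simp)

theorem isBigO_taylor_one {f : E → F} (hf : ContDiff ℝ (⊤ : ℕ∞) f) :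
    (fun z => f z - f 0 - fderiv ℝ f 0 z) =O[𝓝 0] fun z => ‖z‖ ^ 2 := by
  have hd : Differentiable ℝ f := hf.differentiable (by simp)
  refine isBigO_pow_succ_of_fderiv (by fun_prop) (by simp) ?_
  refine (isBigO_sub_apply_zero (contDiff_fderiv hf)).congr (fun z => ?_) (by simp)
  rw [fderiv_fun_sub (by fun_prop) (by fun_prop), fderiv_sub_const]
  simp

/-- The Hessian term is `D²f(0)(z, z)`; symmetry of second derivatives gives its differential. -/
theorem isBigO_taylor_two {f : E → F} (hf : ContDiff ℝ (⊤ : ℕ∞) f) :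
    (fun z => f z - f 0 - fderiv ℝ f 0 z - (1 / 2 : ℝ) • fderiv ℝ (fderiv ℝ f) 0 z z)
      =O[𝓝 0] fun z => ‖z‖ ^ 3 := by
  have hd : Differentiable ℝ f := hf.differentiable (by simp)
  set H := fderiv ℝ (fderiv ℝ f) 0 with hH
  have hsymm : IsSymmSndFDerivAt ℝ f 0 := 
    hf.contDiffAt.isSymmSndFDerivAt (by simpa using WithTop.coe_le_coe.2 (le_top (a := (2 : ℕ∞))))
  have hq : ∀ z : E, HasFDerivAt (fun z => H z z) ((2 : ℝ) • H z) z := by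
    intro z
    have h1 : HasFDerivAt (fun z => H z z) _ z :=
      (H.hasFDerivAt (x := z)).clm_apply (hasFDerivAt_id z)
    refine h1.congr_fderiv ?_
    ext w
    have := hsymm z w
    simp only [← hH] at this
    simp [two_smul, this]
  refine isBigO_pow_succ_of_fderiv ?_ (by simp) ?_
  · have : Differentiable ℝ fun z => H z z := fun z => (hq z).differentiableAt
    fun_prop
  refine (isBigO_taylor_one (contDiff_fderiv hf)).congr (fun z => ?_) (by simp)
  have h2 : HasFDerivAt
      (fun z => f z - f 0 - fderiv ℝ f 0 z - (1 / 2 : ℝ) • fderiv ℝ (fderiv ℝ f) 0 z z)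
      (fderiv ℝ f z - fderiv ℝ f 0 - (1 / 2 : ℝ) • ((2 : ℝ) • H z)) z :=
    (((hd z).hasFDerivAt.sub_const _).sub (fderiv ℝ f 0).hasFDerivAt).sub ((hq z).const_smul _)
  rw [h2.fderiv, smul_smul]
  norm_num [hH]

/-! ### Directional derivatives and the straightening map -/

/-- The derivative `Dh · f` of `h` along the vector field `f`. -/
noncomputable def dirDeriv (f h : E → E) (z : E) : E := fderiv ℝ h z (f z)

theorem contDiff_dirDeriv {f h : E → E} (hf : ContDiff ℝ (⊤ : ℕ∞) f)
    (hh : ContDiff ℝ (⊤ : ℕ∞) h) : ContDiff ℝ (⊤ : ℕ∞) (dirDeriv f h) :=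
  (contDiff_fderiv hh).clm_apply hf

theorem fderiv_dirDeriv_apply {f h : E → E} (hf : ContDiff ℝ (⊤ : ℕ∞) f)
    (hh : ContDiff ℝ (⊤ : ℕ∞) h) (z w : E) :
    fderiv ℝ (dirDeriv f h) z w =
      fderiv ℝ (fderiv ℝ h) z w (f z) + fderiv ℝ h z (fderiv ℝ f z w) := by
  have h1 := (((contDiff_fderiv hh).differentiable (by simp)) z).hasFDerivAt.clm_apply
    ((hf.differentiable (by simp)) z).hasFDerivAt
  have h2 : fderiv ℝ (dirDeriv f h) z = _ := h1.fderiv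
  rw [h2]
  simp [add_comm]

/-- The value at an equilibrium `0` of `g` of the bracket `[f, [g, f]]`, in terms of the
Taylor coefficients of `f` and `g`. -/
theorem lieBracket_lieBracket_zero {f g : E → E} (hf : ContDiff ℝ (⊤ : ℕ∞) f)
    (hg : ContDiff ℝ (⊤ : ℕ∞) g) (hg0 : g 0 = 0) :
    lieBracket ℝ f (lieBracket ℝ g f) 0 =
      (2 : ℝ) • fderiv ℝ f 0 (fderiv ℝ g 0 (f 0)) - fderiv ℝ (fderiv ℝ g) 0 (f 0) (f 0)
        - fderiv ℝ g 0 (fderiv ℝ f 0 (f 0)) := by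
  have e : lieBracket ℝ g f = dirDeriv g f - dirDeriv f g := by
    ext1 z; simp [lieBracket, dirDeriv]
  have d1 := (contDiff_dirDeriv hg hf).differentiable (by simp)
  have d2 := (contDiff_dirDeriv hf hg).differentiable (by simp)
  rw [lieBracket, e, fderiv_sub (d1 0) (d2 0), sub_apply,
    fderiv_dirDeriv_apply hg hf, fderiv_dirDeriv_apply hf hg]
  simp [dirDeriv, hg0, two_smul]
  abel

/-- The Taylor polynomial of degree three in `s` of `z ↦ exp (-s f) z`, the flow of `-f` at
time `s`. Along `z' = g + w f(z)`, `s' = w`, the truncation leaves an error `w s³` in the velocity,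
which is negligible with respect to `s²` even when `w` is merely bounded. -/
noncomputable def straighten (f : E → E) (s : ℝ) (z : E) : E :=
  z - s • f z + (s ^ 2 / 2) • dirDeriv f f z - (s ^ 3 / 6) • dirDeriv f (dirDeriv f f) z

/-- The time derivative of `straighten f s z` along `z' = g + w • f z`, `s' = w`. -/
noncomputable def straightenVel (f : E → E) (w s : ℝ) (z g : E) : E :=
  g - s • fderiv ℝ f z g + (s ^ 2 / 2) • fderiv ℝ (dirDeriv f f) z g
    - (s ^ 3 / 6) • fderiv ℝ (dirDeriv f (dirDeriv f f)) z (g + w • f z)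

theorem hasDerivAt_straighten {f : E → E} (hf : ContDiff ℝ (⊤ : ℕ∞) f) {s : ℝ → ℝ} {z : ℝ → E}
    {t w : ℝ} {g : E} (hs : HasDerivAt s w t) (hz : HasDerivAt z (g + w • f (z t)) t) :
    HasDerivAt (fun t => straighten f (s t) (z t)) (straightenVel f w (s t) (z t) g) t := by
  have hp := contDiff_dirDeriv hf hf
  have hq := contDiff_dirDeriv hf hp
  have d0 := ((hf.differentiable (by simp)) (z t)).hasFDerivAt.comp_hasDerivAt t hz
  have d1 := ((hp.differentiable (by simp)) (z t)).hasFDerivAt.comp_hasDerivAt t hz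
  have d2 := ((hq.differentiable (by simp)) (z t)).hasFDerivAt.comp_hasDerivAt t hz
  have key := ((hz.sub (hs.smul d0)).add (((hs.pow 2).div_const 2).smul d1)).sub
    (((hs.pow 3).div_const 6).smul d2)
  refine key.congr_deriv ?_
  have e0 : fderiv ℝ f (z t) (f (z t)) = dirDeriv f f (z t) := rfl
  have e1 : fderiv ℝ (dirDeriv f f) (z t) (f (z t)) = dirDeriv f (dirDeriv f f) (z t) := rfl
  simp only [straightenVel, map_add, map_smul, Function.comp, e0, e1, Pi.pow_apply]
  module

end Expansions

/-! ### Remainders measured by powers of a small quantity -/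

section Asymp

theorem isBigO_pow_of_le {E α : Type*} [NormedAddCommGroup E] {l : Filter α} {N : α → ℝ} (hN : Tendsto N l (𝓝 0)) {x : α → E} {i j : ℕ} (hij : j ≤ i)
    (hx : x =O[l] fun a => N a ^ i) : x =O[l] fun a => N a ^ j := by
  refine hx.trans ?_
  have h1 : N =O[l] fun _ => (1 : ℝ) := hN.isBigO_one ℝ
  have := (isBigO_refl (fun a => N a ^ j) l).mul (h1.pow (i - j))
  refine this.congr (fun a => ?_) (fun a => by simp)
  rw [← pow_add, Nat.add_sub_cancel' hij]

variable {E F α : Type*} [NormedAddCommGroup E] [NormedSpace ℝ E]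
  [NormedAddCommGroup F] [NormedSpace ℝ F] {l : Filter α}

theorem isBigO_clm_apply {L : α → E →L[ℝ] F} {x : α → E} {N : α → ℝ} {i j : ℕ}
    (hL : L =O[l] fun a => N a ^ i) (hx : x =O[l] fun a => N a ^ j) :
    (fun a => L a (x a)) =O[l] fun a => N a ^ (i + j) := by
  have h : (fun a => L a (x a)) =O[l] fun a => ‖L a‖ * ‖x a‖ :=
    IsBigO.of_bound 1 (Eventually.of_forall fun a => by
      simpa using (L a).le_opNorm (x a))
  exact h.trans ((hL.norm_left.mul hx.norm_left).congr_right fun a => by rw [pow_add])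

theorem isBigO_smul_pow {c : α → ℝ} {x : α → E} {N : α → ℝ} {i j : ℕ}
    (hc : c =O[l] fun a => N a ^ i) (hx : x =O[l] fun a => N a ^ j) :
    (fun a => c a • x a) =O[l] fun a => N a ^ (i + j) :=
  (hc.smul hx).congr_right fun a => by rw [smul_eq_mul, pow_add]

end Asymp

/-! ### Velocity of the straightened state -/

section Velocity

variable {E α : Type*} [NormedAddCommGroup E] {l : Filter α}
  {f₀ f₁ f₂ : E → E} {v w s : α → ℝ} {z : α → E}

/-- Smallness and boundedness assumptions on a family of control values `v`, `w`, primitives `s`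
and states `z`. -/
structure SmallFamily (l : Filter α) (v w s : α → ℝ) (z : α → E) : Prop where
  bdd_v : v =O[l] fun _ => (1 : ℝ)
  bdd_w : w =O[l] fun _ => (1 : ℝ)
  tendsto_s : Tendsto s l (𝓝 0)
  tendsto_z : Tendsto z l (𝓝 0)

/-- The joint size of `s` and `z`, the unit in which remainders are measured. -/
def size (s : α → ℝ) (z : α → E) (a : α) : ℝ := ‖s a‖ + ‖z a‖

namespace SmallFamily

theorem tendsto_size (h : SmallFamily l v w s z) : Tendsto (size s z) l (𝓝 0) := by
  simpa [size, Function.comp_def] using! h.tendsto_s.norm.add h.tendsto_z.norm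

theorem s_isBigO (s : α → ℝ) (z : α → E) : s =O[l] fun a => size s z a ^ 1 :=
  IsBigO.of_bound 1 (Eventually.of_forall fun a => by
    rw [pow_one, size, Real.norm_of_nonneg (r := ‖s a‖ + ‖z a‖) (by positivity), one_mul]
    linarith [norm_nonneg (z a)])

theorem z_isBigO (s : α → ℝ) (z : α → E) : z =O[l] fun a => size s z a ^ 1 :=
  IsBigO.of_bound 1 (Eventually.of_forall fun a => by
    rw [pow_one, size, Real.norm_of_nonneg (r := ‖s a‖ + ‖z a‖) (by positivity), one_mul]
    linarith [norm_nonneg (s a)])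

theorem comp_isBigO (h : SmallFamily l v w s z) {F : Type*} [NormedAddCommGroup F]
    {R : E → F} {k : ℕ} (hR : R =O[𝓝 0] fun z => ‖z‖ ^ k) :
    (fun a => R (z a)) =O[l] fun a => size s z a ^ k :=
  (hR.comp_tendsto h.tendsto_z).trans
    ((((z_isBigO s z).norm_left).pow k).congr_right fun a => by simp)

theorem bdd_comp (h : SmallFamily l v w s z) {F : Type*} [NormedAddCommGroup F]
    {R : E → F} (hR : Continuous R) :
    (fun a => R (z a)) =O[l] fun a => size s z a ^ 0 := by
  simpa using ((hR.tendsto 0).comp h.tendsto_z).isBigO_one ℝ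

theorem bdd_const {F : Type*} [NormedAddCommGroup F] (s : α → ℝ) (z : α → E) (c : F) :
    (fun _ => c) =O[l] fun a => size s z a ^ 0 := by
  simpa using isBigO_const_const c (one_ne_zero (α := ℝ)) l

theorem bdd_v' (h : SmallFamily l v w s z) : v =O[l] fun a => size s z a ^ 0 := by
  simpa using h.bdd_v

theorem bdd_w' (h : SmallFamily l v w s z) : w =O[l] fun a => size s z a ^ 0 := by
  simpa using h.bdd_w

theorem pow_le (h : SmallFamily l v w s z) {F : Type*} [NormedAddCommGroup F]
    {x : α → F} {i j : ℕ}
    (hij : j ≤ i) (hx : x =O[l] fun a => size s z a ^ i) : x =O[l] fun a => size s z a ^ j :=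
  isBigO_pow_of_le h.tendsto_size hij hx

variable [NormedSpace ℝ E]

theorem drift_isBigO (h : SmallFamily l v w s z) (hf₀ : ContDiff ℝ (⊤ : ℕ∞) f₀)
    (hf₂ : ContDiff ℝ (⊤ : ℕ∞) f₂) (h0 : f₀ 0 = 0) (h2 : f₂ 0 = 0) :
    (fun a => f₀ (z a) + v a • f₂ (z a)) =O[l] fun a => size s z a ^ 1 := by
  have i0 := h.comp_isBigO (k := 1) (by simpa [h0] using isBigO_sub_apply_zero hf₀)
  have i2 := h.comp_isBigO (k := 1) (by simpa [h2] using isBigO_sub_apply_zero hf₂)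
  exact i0.add (by simpa only [zero_add] using isBigO_smul_pow h.bdd_v' i2)

/-- The linear part at `0` of the drift `f₀ + v f₂`. -/
noncomputable def lin (f₀ f₂ : E → E) (v : ℝ) : E →L[ℝ] E := fderiv ℝ f₀ 0 + v • fderiv ℝ f₂ 0

/-- The Hessian at `0` of the drift `f₀ + v f₂`. -/
noncomputable def hess (f₀ f₂ : E → E) (v : ℝ) : E →L[ℝ] E →L[ℝ] E :=
  fderiv ℝ (fderiv ℝ f₀) 0 + v • fderiv ℝ (fderiv ℝ f₂) 0

theorem lin_isBigO (h : SmallFamily l v w s z) :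
    (fun a => lin f₀ f₂ (v a)) =O[l] fun a => size s z a ^ 0 :=
  (bdd_const s z _).add (by simpa only [zero_add] using isBigO_smul_pow h.bdd_v' (bdd_const s z (fderiv ℝ f₂ 0)))

theorem hess_isBigO (h : SmallFamily l v w s z) :
    (fun a => hess f₀ f₂ (v a)) =O[l] fun a => size s z a ^ 0 :=
  (bdd_const s z _).add
    (by simpa only [zero_add] using isBigO_smul_pow h.bdd_v' (bdd_const s z (fderiv ℝ (fderiv ℝ f₂) 0)))

theorem drift_sub_lin (h : SmallFamily l v w s z) (hf₀ : ContDiff ℝ (⊤ : ℕ∞) f₀)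
    (hf₂ : ContDiff ℝ (⊤ : ℕ∞) f₂) (h0 : f₀ 0 = 0) (h2 : f₂ 0 = 0) :
    (fun a => f₀ (z a) + v a • f₂ (z a) - lin f₀ f₂ (v a) (z a))
      =O[l] fun a => size s z a ^ 2 := by
  have i0 := h.comp_isBigO (isBigO_taylor_one hf₀)
  have i2 := isBigO_smul_pow h.bdd_v' (h.comp_isBigO (isBigO_taylor_one hf₂))
  rw [zero_add] at i2
  refine (i0.add i2).congr_left fun a => ?_
  simp [lin, h0, h2, smul_sub]
  abel

theorem drift_sub_taylor (h : SmallFamily l v w s z) (hf₀ : ContDiff ℝ (⊤ : ℕ∞) f₀)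
    (hf₂ : ContDiff ℝ (⊤ : ℕ∞) f₂) (h0 : f₀ 0 = 0) (h2 : f₂ 0 = 0) :
    (fun a => f₀ (z a) + v a • f₂ (z a) - lin f₀ f₂ (v a) (z a)
      - (1 / 2 : ℝ) • hess f₀ f₂ (v a) (z a) (z a)) =O[l] fun a => size s z a ^ 3 := by
  have i0 := h.comp_isBigO (isBigO_taylor_two hf₀)
  have i2 := isBigO_smul_pow h.bdd_v' (h.comp_isBigO (isBigO_taylor_two hf₂))
  rw [zero_add] at i2
  refine (i0.add i2).congr_left fun a => ?_
  simp only [lin, hess, h0, h2, add_apply, FunLike.coe_smul, Pi.smul_apply]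
  module

theorem straighten_sub_state (h : SmallFamily l v w s z) (hf : ContDiff ℝ (⊤ : ℕ∞) f₁) :
    (fun a => straighten f₁ (s a) (z a) - z a) =O[l] s := by
  have hp := contDiff_dirDeriv hf hf
  have hq := contDiff_dirDeriv hf hp
  have b0 := h.bdd_comp hf.continuous
  have b1 := h.bdd_comp hp.continuous
  have b2 := h.bdd_comp hq.continuous
  have hs0 := h.pow_le (Nat.zero_le _) (s_isBigO s z)
  have hs : ∀ a, s a * 1 = s a := fun a => mul_one _
  have key : (fun a => - f₁ (z a) + (s a) • ((1 / 2 : ℝ) • dirDeriv f₁ f₁ (z a))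
      - (s a) • (s a) • ((1 / 6 : ℝ) • dirDeriv f₁ (dirDeriv f₁ f₁) (z a)))
      =O[l] fun a => size s z a ^ 0 :=
    (b0.neg_left.add (isBigO_smul_pow hs0 (b1.const_smul_left _))).sub
      (isBigO_smul_pow hs0 (isBigO_smul_pow hs0 (b2.const_smul_left _)))
  refine ((isBigO_refl s l).smul key).congr (fun a => ?_) (fun a => by simp)
  simp only [straighten]
  module

theorem straighten_sub_one (h : SmallFamily l v w s z) (hf : ContDiff ℝ (⊤ : ℕ∞) f₁) :
    (fun a => straighten f₁ (s a) (z a) - (z a - s a • f₁ 0))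
      =O[l] fun a => size s z a ^ 2 := by
  have hp := contDiff_dirDeriv hf hf
  have hq := contDiff_dirDeriv hf hp
  have b0 := h.comp_isBigO (k := 1) (by simpa using isBigO_sub_apply_zero hf)
  have b1 := h.bdd_comp hp.continuous
  have b2 := h.bdd_comp hq.continuous
  have hs := s_isBigO (l := l) s z
  have hs0 := h.pow_le (Nat.zero_le _) hs
  have e1 := isBigO_smul_pow hs b0
  have e2 := isBigO_smul_pow hs (isBigO_smul_pow hs (b1.const_smul_left (1 / 2 : ℝ)))
  have e3 := isBigO_smul_pow hs (isBigO_smul_pow hs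
    (isBigO_smul_pow hs0 (b2.const_smul_left (1 / 6 : ℝ))))
  refine ((e1.neg_left.add e2).sub e3).congr_left fun a => ?_
  simp only [straighten, Pi.smul_apply]
  module

theorem straighten_sub_two (h : SmallFamily l v w s z) (hf : ContDiff ℝ (⊤ : ℕ∞) f₁) :
    (fun a => straighten f₁ (s a) (z a) - (z a - s a • f₁ 0 - s a • fderiv ℝ f₁ 0 (z a)
      + (s a ^ 2 / 2) • fderiv ℝ f₁ 0 (f₁ 0))) =O[l] fun a => size s z a ^ 3 := by
  have hp := contDiff_dirDeriv hf hf
  have hq := contDiff_dirDeriv hf hp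
  have b0 := h.comp_isBigO (isBigO_taylor_one hf)
  have b1 := h.comp_isBigO (k := 1) (by simpa using isBigO_sub_apply_zero hp)
  have b2 := h.bdd_comp hq.continuous
  have hs := s_isBigO (l := l) s z
  have e1 := isBigO_smul_pow hs b0
  have e2 := isBigO_smul_pow hs (isBigO_smul_pow hs (b1.const_smul_left (1 / 2 : ℝ)))
  have e3 := isBigO_smul_pow hs (isBigO_smul_pow hs
    (isBigO_smul_pow hs (b2.const_smul_left (1 / 6 : ℝ))))
  refine ((e1.neg_left.add e2).sub e3).congr_left fun a => ?_
  have e : dirDeriv f₁ f₁ 0 = fderiv ℝ f₁ 0 (f₁ 0) := rfl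
  simp only [straighten, Pi.smul_apply, e]
  module

/-- First order expansion of the velocity of the straightened state. -/
theorem straightenVel_sub_lin (h : SmallFamily l v w s z) (hf₀ : ContDiff ℝ (⊤ : ℕ∞) f₀)
    (hf₁ : ContDiff ℝ (⊤ : ℕ∞) f₁) (hf₂ : ContDiff ℝ (⊤ : ℕ∞) f₂) (h0 : f₀ 0 = 0)
    (h2 : f₂ 0 = 0) :
    (fun a => straightenVel f₁ (w a) (s a) (z a) (f₀ (z a) + v a • f₂ (z a))
      - lin f₀ f₂ (v a) (z a)) =O[l] fun a => size s z a ^ 2 := by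
  have hp := contDiff_dirDeriv hf₁ hf₁
  have hq := contDiff_dirDeriv hf₁ hp
  have d0 := h.bdd_comp (contDiff_fderiv hf₁).continuous
  have d1 := h.bdd_comp (contDiff_fderiv hp).continuous
  have d2 := h.bdd_comp (contDiff_fderiv hq).continuous
  have hs := s_isBigO (l := l) s z
  have hs0 := h.pow_le (Nat.zero_le _) hs
  have hg := h.drift_isBigO hf₀ hf₂ h0 h2
  have hg0 := h.pow_le (Nat.zero_le _) hg
  have hw := isBigO_smul_pow h.bdd_w' (h.bdd_comp hf₁.continuous)
  have e1 := isBigO_smul_pow hs (isBigO_clm_apply d0 hg)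
  have e2 := isBigO_smul_pow hs (isBigO_smul_pow hs
    (isBigO_clm_apply d1 (hg0.const_smul_left (1 / 2 : ℝ))))
  have e3 := isBigO_smul_pow hs (isBigO_smul_pow hs (isBigO_smul_pow hs0
    (isBigO_clm_apply d2 ((hg0.add hw).const_smul_left (1 / 6 : ℝ)))))
  refine (((h.drift_sub_lin hf₀ hf₂ h0 h2).sub e1).add (e2.sub e3)).congr_left fun a => ?_
  simp only [straightenVel, Pi.smul_apply, map_smul]
  module

/-- Second order expansion of the velocity of the straightened state. -/
theorem straightenVel_sub_taylor (h : SmallFamily l v w s z) (hf₀ : ContDiff ℝ (⊤ : ℕ∞) f₀)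
    (hf₁ : ContDiff ℝ (⊤ : ℕ∞) f₁) (hf₂ : ContDiff ℝ (⊤ : ℕ∞) f₂) (h0 : f₀ 0 = 0)
    (h2 : f₂ 0 = 0) :
    (fun a => straightenVel f₁ (w a) (s a) (z a) (f₀ (z a) + v a • f₂ (z a))
      - (lin f₀ f₂ (v a) (z a) + (1 / 2 : ℝ) • hess f₀ f₂ (v a) (z a) (z a)
        - s a • fderiv ℝ f₁ 0 (lin f₀ f₂ (v a) (z a)))) =O[l] fun a => size s z a ^ 3 := by
  have hp := contDiff_dirDeriv hf₁ hf₁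
  have hq := contDiff_dirDeriv hf₁ hp
  have d0 := h.comp_isBigO (k := 1) (by simpa using isBigO_sub_apply_zero (contDiff_fderiv hf₁))
  have d1 := h.bdd_comp (contDiff_fderiv hp).continuous
  have d2 := h.bdd_comp (contDiff_fderiv hq).continuous
  have hs := s_isBigO (l := l) s z
  have hg := h.drift_isBigO hf₀ hf₂ h0 h2
  have hg0 := h.pow_le (Nat.zero_le _) hg
  have hw := isBigO_smul_pow h.bdd_w' (h.bdd_comp hf₁.continuous)
  have e1 := isBigO_smul_pow hs (isBigO_clm_apply d0 hg)
  have e1' := isBigO_smul_pow hs (isBigO_clm_apply (bdd_const s z (fderiv ℝ f₁ 0))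
    (h.drift_sub_lin hf₀ hf₂ h0 h2))
  have e2 := isBigO_smul_pow hs (isBigO_smul_pow hs
    (isBigO_clm_apply d1 (hg.const_smul_left (1 / 2 : ℝ))))
  have e3 := isBigO_smul_pow hs (isBigO_smul_pow hs (isBigO_smul_pow hs
    (isBigO_clm_apply d2 ((hg0.add hw).const_smul_left (1 / 6 : ℝ)))))
  refine (((h.drift_sub_taylor hf₀ hf₂ h0 h2).sub (e1.add e1')).add (e2.sub e3)).congr_left
    fun a => ?_
  simp only [straightenVel, Pi.smul_apply, map_smul, map_add, map_sub, sub_apply]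
  module

end SmallFamily
end Velocity

/-! ### Velocity modulo the invariant subspace -/

namespace SmallFamily

variable {E α : Type*} [NormedAddCommGroup E] [NormedSpace ℝ E] {l : Filter α}
  {f₀ f₁ f₂ : E → E} {v w s : α → ℝ} {z : α → E}

theorem state_isBigO (h : SmallFamily l v w s z) (hf : ContDiff ℝ (⊤ : ℕ∞) f₁) :
    z =O[l] fun a => ‖straighten f₁ (s a) (z a)‖ + |s a| := by
  have h1 : (fun a => straighten f₁ (s a) (z a)) =O[l]
      fun a => ‖straighten f₁ (s a) (z a)‖ + |s a| :=
    IsBigO.of_bound 1 (Eventually.of_forall fun a => by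
      rw [Real.norm_of_nonneg (by positivity)]; linarith [abs_nonneg (s a)])
  have h2 : s =O[l] fun a => ‖straighten f₁ (s a) (z a)‖ + |s a| :=
    IsBigO.of_bound 1 (Eventually.of_forall fun a => by
      rw [Real.norm_of_nonneg (r := _ + _) (by positivity), Real.norm_eq_abs]
      linarith [norm_nonneg (straighten f₁ (s a) (z a))])
  exact (h1.sub ((h.straighten_sub_state hf).trans h2)).congr_left fun a => by abel

theorem size_isBigO (h : SmallFamily l v w s z) (hf : ContDiff ℝ (⊤ : ℕ∞) f₁) :
    size s z =O[l] fun a => ‖straighten f₁ (s a) (z a)‖ + |s a| := by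
  have h2 : s =O[l] fun a => ‖straighten f₁ (s a) (z a)‖ + |s a| :=
    IsBigO.of_bound 1 (Eventually.of_forall fun a => by
      rw [Real.norm_of_nonneg (r := _ + _) (by positivity), Real.norm_eq_abs]
      linarith [norm_nonneg (straighten f₁ (s a) (z a))])
  exact h2.norm_left.add (h.state_isBigO hf).norm_left

theorem size_sq_isBigO (h : SmallFamily l v w s z) (hf : ContDiff ℝ (⊤ : ℕ∞) f₁) :
    (fun a => size s z a ^ 2) =O[l] fun a => ‖straighten f₁ (s a) (z a)‖ ^ 2 + s a ^ 2 := by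
  refine ((h.size_isBigO hf).pow 2).trans (IsBigO.of_bound 2 (Eventually.of_forall fun a => ?_))
  rw [Real.norm_of_nonneg (by positivity), Real.norm_of_nonneg (by positivity), ← sq_abs (s a)]
  nlinarith [sq_nonneg (‖straighten f₁ (s a) (z a)‖ - |s a|)]

/-- Crude bound on the velocity of the straightened state. -/
theorem straightenVel_isBigO (h : SmallFamily l v w s z) (hf₀ : ContDiff ℝ (⊤ : ℕ∞) f₀)
    (hf₁ : ContDiff ℝ (⊤ : ℕ∞) f₁) (hf₂ : ContDiff ℝ (⊤ : ℕ∞) f₂) (h0 : f₀ 0 = 0)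
    (h2 : f₂ 0 = 0) :
    (fun a => straightenVel f₁ (w a) (s a) (z a) (f₀ (z a) + v a • f₂ (z a)))
      =O[l] fun a => ‖straighten f₁ (s a) (z a)‖ + |s a| := by
  have e1 := isBigO_clm_apply (h.lin_isBigO (f₀ := f₀) (f₂ := f₂)) (z_isBigO s z)
  have e2 := h.pow_le (j := 1) (by norm_num) (h.straightenVel_sub_lin hf₀ hf₁ hf₂ h0 h2)
  have := (e2.add e1).congr_left fun a => sub_add_cancel _ _
  simp only [pow_one] at this
  exact this.trans (h.size_isBigO hf₁)

theorem factor_lin {F : Type*} [NormedAddCommGroup F] [NormedSpace ℝ F] {Q : E →L[ℝ] E}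
    {L : E →L[ℝ] F}
    (hL₀ : ∀ x, L (fderiv ℝ f₀ 0 x) = L (fderiv ℝ f₀ 0 (Q x)))
    (hL₂ : ∀ x, L (fderiv ℝ f₂ 0 x) = L (fderiv ℝ f₂ 0 (Q x))) (c : ℝ) (x : E) :
    L (lin f₀ f₂ c x) = L (lin f₀ f₂ c (Q x)) := by
  simp [lin, hL₀ x, hL₂ x]

/-- If `L ∘ Dfᵢ(0)` factors through `Q`, and `Q` kills `f₁(0)`, then the terms of first order in
the velocity of `L` of the straightened state involve only its image under `Q`. -/
theorem map_straightenVel_isBigO {F : Type*} [NormedAddCommGroup F] [NormedSpace ℝ F]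
    {Q : E →L[ℝ] E} {L : E →L[ℝ] F} (h : SmallFamily l v w s z)
    (hf₀ : ContDiff ℝ (⊤ : ℕ∞) f₀)
    (hf₁ : ContDiff ℝ (⊤ : ℕ∞) f₁) (hf₂ : ContDiff ℝ (⊤ : ℕ∞) f₂) (h0 : f₀ 0 = 0)
    (h2 : f₂ 0 = 0) (hQ : Q (f₁ 0) = 0)
    (hL₀ : ∀ x, L (fderiv ℝ f₀ 0 x) = L (fderiv ℝ f₀ 0 (Q x)))
    (hL₂ : ∀ x, L (fderiv ℝ f₂ 0 x) = L (fderiv ℝ f₂ 0 (Q x))) :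
    (fun a => L (straightenVel f₁ (w a) (s a) (z a) (f₀ (z a) + v a • f₂ (z a))))
      =O[l] fun a => ‖Q (straighten f₁ (s a) (z a))‖
        + (‖straighten f₁ (s a) (z a)‖ ^ 2 + s a ^ 2) := by
  set R := fun a => ‖Q (straighten f₁ (s a) (z a))‖
        + (‖straighten f₁ (s a) (z a)‖ ^ 2 + s a ^ 2) with hR
  have hQR : (fun a => Q (straighten f₁ (s a) (z a))) =O[l] R :=
    IsBigO.of_bound 1 (Eventually.of_forall fun a => by
      rw [hR, Real.norm_of_nonneg (r := _ + _) (by positivity), one_mul]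
      exact le_add_of_nonneg_right (by positivity))
  have hNR : (fun a => size s z a ^ 2) =O[l] R :=
    (h.size_sq_isBigO hf₁).trans <|
    IsBigO.of_bound 1 (Eventually.of_forall fun a => by
      rw [hR, Real.norm_of_nonneg (by positivity), Real.norm_of_nonneg (by positivity), one_mul]
      exact le_add_of_nonneg_left (by positivity))
  have e1 : (fun a => lin f₀ f₂ (v a) (Q (straighten f₁ (s a) (z a)))) =O[l] R := by
    have hb : (fun a => ‖lin f₀ f₂ (v a)‖) =O[l] fun _ => (1 : ℝ) := by
      simpa using (h.lin_isBigO (f₀ := f₀) (f₂ := f₂)).norm_left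
    refine IsBigO.trans (IsBigO.of_bound 1 (Eventually.of_forall fun a => ?_))
      ((hb.mul hQR.norm_left).congr_right fun a => one_mul _)
    simpa using (lin f₀ f₂ (v a)).le_opNorm _
  have e2 := (h.straightenVel_sub_lin hf₀ hf₁ hf₂ h0 h2)
  have e3 := isBigO_clm_apply (h.lin_isBigO (f₀ := f₀) (f₂ := f₂))
    (isBigO_clm_apply (bdd_const s z Q) (h.straighten_sub_one hf₁))
  simp only [zero_add] at e3
  refine (((L.isBigO_comp _ l).trans e1).add ((L.isBigO_comp _ l).trans
    ((e2.trans hNR).sub (e3.trans hNR)))).congr_left fun a => ?_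
  simp only [map_sub, map_smul, hQ, factor_lin hL₀ hL₂ _ (z a), smul_zero, sub_zero]
  abel

/-- Twice the quadratic part in `s` of minus the velocity; it is the bracket
`[f₁, [f₀ + v f₂, f₁]](0)`. -/
noncomputable def quadCoeff (f₀ f₁ f₂ : E → E) (v : ℝ) : E :=
  (2 : ℝ) • fderiv ℝ f₁ 0 (lin f₀ f₂ v (f₁ 0)) - hess f₀ f₂ v (f₁ 0) (f₁ 0)
    - lin f₀ f₂ v (fderiv ℝ f₁ 0 (f₁ 0))

theorem quadCoeff_eq (hf₀ : ContDiff ℝ (⊤ : ℕ∞) f₀)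
    (hf₁ : ContDiff ℝ (⊤ : ℕ∞) f₁) (hf₂ : ContDiff ℝ (⊤ : ℕ∞) f₂) (h0 : f₀ 0 = 0)
    (h2 : f₂ 0 = 0) (v : ℝ) :
    quadCoeff f₀ f₁ f₂ v = lieBracket ℝ f₁ (lieBracket ℝ f₀ f₁) 0
      + v • lieBracket ℝ f₁ (lieBracket ℝ f₂ f₁) 0 := by
  rw [lieBracket_lieBracket_zero hf₁ hf₀ h0, lieBracket_lieBracket_zero hf₁ hf₂ h2]
  simp only [quadCoeff, lin, hess, add_apply, FunLike.coe_smul, Pi.smul_apply, map_add, map_smul]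
  module

/-- If `φ ∘ Dfᵢ(0)` factors through `Q`, and `Q` kills `f₁(0)`, then the velocity of `φ` of the
straightened state is `-(s² / 2) φ([f₁, [f₀ + v f₂, f₁]](0))` up to terms which are either linear in
the image of the straightened state `x` under `Q`, or quadratic and divisible by `x`, or
cubic in `(s, z)`. -/
theorem map_straightenVel_add_quadCoeff_isBigO
    {Q : E →L[ℝ] E} {φ : E →L[ℝ] ℝ} (h : SmallFamily l v w s z)
    (hf₀ : ContDiff ℝ (⊤ : ℕ∞) f₀)
    (hf₁ : ContDiff ℝ (⊤ : ℕ∞) f₁) (hf₂ : ContDiff ℝ (⊤ : ℕ∞) f₂) (h0 : f₀ 0 = 0)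
    (h2 : f₂ 0 = 0) (hQ : Q (f₁ 0) = 0)
    (hφ₀ : ∀ x, φ (fderiv ℝ f₀ 0 x) = φ (fderiv ℝ f₀ 0 (Q x)))
    (hφ₂ : ∀ x, φ (fderiv ℝ f₂ 0 x) = φ (fderiv ℝ f₂ 0 (Q x))) :
    (fun a => φ (straightenVel f₁ (w a) (s a) (z a) (f₀ (z a) + v a • f₂ (z a)))
        + (s a ^ 2 / 2) * φ (quadCoeff f₀ f₁ f₂ (v a)))
      =O[l] fun a => ‖Q (straighten f₁ (s a) (z a))‖
        + |s a| * ‖straighten f₁ (s a) (z a)‖ + ‖straighten f₁ (s a) (z a)‖ ^ 2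
        + size s z a ^ 3 := by
  set X := fun a => straighten f₁ (s a) (z a) with hX
  set R := fun a => ‖Q (straighten f₁ (s a) (z a))‖
        + |s a| * ‖straighten f₁ (s a) (z a)‖ + ‖straighten f₁ (s a) (z a)‖ ^ 2
        + size s z a ^ 3 with hR
  have hsize : ∀ a, 0 ≤ size s z a := fun a => by unfold size; positivity
  have hR0 : ∀ a, 0 ≤ R a := fun a => by have := hsize a; simp only [hR]; positivity
  have hQR : (fun a => Q (X a)) =O[l] R :=
    IsBigO.of_bound 1 (Eventually.of_forall fun a => by
      have := hsize a
      rw [Real.norm_of_nonneg (hR0 a), one_mul]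
      simp only [hR, add_assoc]
      exact le_add_of_nonneg_right (by positivity))
  have hNR : (fun a => size s z a ^ 3) =O[l] R :=
    IsBigO.of_bound 1 (Eventually.of_forall fun a => by
      have := hsize a
      rw [Real.norm_of_nonneg (hR0 a), Real.norm_of_nonneg (by positivity), one_mul]
      simp only [hR]
      exact le_add_of_nonneg_left (by positivity))
  have hXR : (fun a => size s z a * ‖X a‖) =O[l] R := by
    refine ((h.size_isBigO hf₁).mul (isBigO_refl (fun a => ‖X a‖) l)).trans ?_
    refine IsBigO.of_bound 1 (Eventually.of_forall fun a => ?_)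
    have := hsize a
    rw [Real.norm_of_nonneg (hR0 a), Real.norm_of_nonneg (by positivity), one_mul]
    simp only [hR, hX]
    have : 0 ≤ ‖Q (straighten f₁ (s a) (z a))‖ := norm_nonneg _
    have : 0 ≤ size s z a ^ 3 := by have := hsize a; positivity
    nlinarith
  -- to first order, the straightened state is `z - s f₁(0)`
  set y := fun a => z a - s a • f₁ 0 with hy
  have hyN : (fun a => X a - y a) =O[l] fun a => size s z a ^ 2 := h.straighten_sub_one hf₁
  have hyR : (fun a => size s z a * ‖y a‖) =O[l] R := by
    have e1 : (fun a => size s z a * ‖X a - y a‖) =O[l] R :=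
      ((isBigO_refl (size s z) l).mul hyN.norm_left).trans
        (hNR.congr_left fun a => by ring)
    refine IsBigO.trans (IsBigO.of_bound 1 (Eventually.of_forall fun a => ?_)) (hXR.add e1)
    have := hsize a
    rw [Real.norm_of_nonneg (by positivity), Real.norm_of_nonneg (by positivity), one_mul,
      ← mul_add]
    gcongr
    simpa using norm_sub_le (X a) (X a - y a)
  have bilin : ∀ {F : Type _} [NormedAddCommGroup F] (r : α → F) (C : α → ℝ),
      C =O[l] (fun a => size s z a ^ 0) → (∀ a, ‖r a‖ ≤ C a * (size s z a * ‖y a‖)) →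
      r =O[l] R := by
    intro F _ r C hC hr
    refine IsBigO.trans (IsBigO.of_bound 1 (Eventually.of_forall fun a => ?_))
      ((hC.mul hyR).congr_right fun a => by rw [pow_zero, one_mul])
    rw [one_mul]
    exact (hr a).trans (le_abs_self _)
  have hsN : ∀ a, |s a| ≤ size s z a := fun a => by
    simp only [size, Real.norm_eq_abs]; linarith [norm_nonneg (z a)]
  have hzN : ∀ a, ‖z a‖ ≤ size s z a := fun a => by
    simp only [size]; linarith [norm_nonneg (s a)]
  have hlin := (h.lin_isBigO (f₀ := f₀) (f₂ := f₂))
  have hhess := (h.hess_isBigO (f₀ := f₀) (f₂ := f₂))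
  have hhn : (fun a => ‖hess f₀ f₂ (v a)‖) =O[l] fun a => size s z a ^ 0 := 
    hhess.norm_left (E' := E →L[ℝ] E →L[ℝ] E)
  set D := fderiv ℝ f₁ 0 with hD
  have linR : ∀ {r : α → E}, r =O[l] R → (fun a => lin f₀ f₂ (v a) (r a)) =O[l] R := by
    intro r hr
    refine IsBigO.trans (IsBigO.of_bound 1 (Eventually.of_forall fun a => ?_))
      ((hlin.norm_left.mul hr.norm_left).congr_right fun a => by rw [pow_zero, one_mul])
    simpa using (lin f₀ f₂ (v a)).le_opNorm _
  have t1 := (h.straightenVel_sub_taylor hf₀ hf₁ hf₂ h0 h2).trans hNR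
  have t2 := linR ((Q.isBigO_comp _ l).trans ((h.straighten_sub_two hf₁).trans hNR))
  have t3 := linR hQR
  have t4 : (fun a => s a • D (y a)) =O[l] R := by
    refine bilin _ (fun _ => ‖D‖) (by simpa using isBigO_const_const ‖D‖ (one_ne_zero (α := ℝ)) l)
      fun a => ?_
    rw [norm_smul, Real.norm_eq_abs]
    calc |s a| * ‖D (y a)‖ ≤ size s z a * (‖D‖ * ‖y a‖) := by
          gcongr
          · exact hsize a
          · exact hsN a
          · exact D.le_opNorm _
      _ = _ := by ring
  have t4' := linR ((Q.isBigO_comp _ l).trans t4)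
  have t5 : (fun a => D (lin f₀ f₂ (v a) (s a • y a))) =O[l] R := by
    refine (D.isBigO_comp _ l).trans (linR (bilin _ (fun _ => 1)
      (by simpa using isBigO_refl (fun _ => (1 : ℝ)) l) fun a => ?_))
    rw [norm_smul, Real.norm_eq_abs, one_mul]
    gcongr
    exact hsN a
  have t6 : (fun a => hess f₀ f₂ (v a) (y a) (z a)) =O[l] R := by
    refine bilin _ (fun a => ‖hess f₀ f₂ (v a)‖) hhn fun a => ?_
    refine ((hess f₀ f₂ (v a)).le_opNorm₂ _ _).trans ?_
    rw [mul_assoc, mul_comm ‖y a‖]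
    gcongr
    exact hzN a
  have t7 : (fun a => hess f₀ f₂ (v a) (f₁ 0) (s a • y a)) =O[l] R := by
    refine bilin _ (fun a => ‖hess f₀ f₂ (v a)‖ * ‖f₁ 0‖)
      ((hhn.mul (isBigO_const_const ‖f₁ 0‖ (one_ne_zero (α := ℝ)) l)).congr_right
        fun a => by simp) fun a => ?_
    refine ((hess f₀ f₂ (v a)).le_opNorm₂ _ _).trans ?_
    rw [norm_smul, Real.norm_eq_abs]
    gcongr
    exact hsN a
  have tot := (((((t1.sub t2).add t3).add t4').sub t5).add (t6.const_smul_left (1 / 2 : ℝ))).add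
    (t7.const_smul_left (1 / 2 : ℝ))
  refine ((φ.isBigO_comp _ l).trans tot).congr_left fun a => ?_
  -- `φ(A z) = φ(A Q z)`, where `z` is expanded by means of the straightened state, and
  -- `z = y + s f₁(0)` in the quadratic terms; the terms in `s²` then add up to the bracket
  have k1 := factor_lin hφ₀ hφ₂ (v a) (z a)
  have k2 := factor_lin hφ₀ hφ₂ (v a) (D (f₁ 0))
  have k3 : z a = y a + s a • f₁ 0 := by simp [hy]
  have k4 : hess f₀ f₂ (v a) (z a) (z a) = hess f₀ f₂ (v a) (y a) (z a)
      + s a • hess f₀ f₂ (v a) (f₁ 0) (y a)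
      + s a ^ 2 • hess f₀ f₂ (v a) (f₁ 0) (f₁ 0) := by
    rw [k3]; simp only [map_add, map_smul, add_apply, FunLike.coe_smul, Pi.smul_apply]; module
  have k5 : D (lin f₀ f₂ (v a) (z a)) = D (lin f₀ f₂ (v a) (y a))
      + s a • D (lin f₀ f₂ (v a) (f₁ 0)) := by
    rw [k3]; simp only [map_add, map_smul]
  have k6 : D (z a) = D (y a) + s a • D (f₁ 0) := by
    rw [k3]; simp only [map_add, map_smul]
  simp only [quadCoeff, k4, k5, k6, map_add, map_sub, map_smul, hQ, smul_eq_mul, k1, k2,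
    Pi.smul_apply, hX, ← hD, smul_zero, map_zero]
  ring

end SmallFamily

/-! ### Uniform estimates near the equilibrium -/

section Uniform

/-- A big-O statement uniform in bounded controls, with explicit constants. Both constants are
produced as eventual properties, so that finitely many estimates can share them. -/
theorem exists_bound_of_isBigO {E F : Type*} [NormedAddCommGroup E] [NormedAddCommGroup F] {M : ℝ}
    {A : (ℝ × ℝ) × ℝ × E → F} {B : (ℝ × ℝ) × ℝ × E → ℝ}
    (h : A =O[𝓟 (Metric.closedBall 0 M) ×ˢ 𝓝 0] B) (hB : ∀ m, 0 ≤ B m) :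
    ∀ᶠ C : ℝ in atTop, ∀ᶠ δ : ℝ in 𝓝[>] 0, ∀ v w s : ℝ, ∀ z : E, |v| ≤ M → |w| ≤ M →
      |s| ≤ δ → ‖z‖ ≤ δ → ‖A ((v, w), (s, z))‖ ≤ C * B ((v, w), (s, z)) := by
  obtain ⟨c, hc⟩ := h.bound
  rw [eventually_prod_iff] at hc
  obtain ⟨pa, ha, pb, hb, hab⟩ := hc
  obtain ⟨ε, hε, hball⟩ := Metric.eventually_nhds_iff.1 hb
  filter_upwards [eventually_ge_atTop c] with C hC
  filter_upwards [Ioo_mem_nhdsGT hε] with δ hδ v w s z hv hw hs hz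
  have h1 : pa (v, w) := by
    refine mem_principal.1 ha ?_
    simp [Prod.norm_def, hv, hw]
  have h2 : pb (s, z) := by
    refine hball ?_
    rw [dist_zero_right, Prod.norm_def, max_lt_iff]
    exact ⟨hs.trans_lt hδ.2, hz.trans_lt hδ.2⟩
  refine (hab h1 h2).trans ?_
  rw [Real.norm_of_nonneg (hB _)]
  exact mul_le_mul_of_nonneg_right hC (hB _)

variable {E : Type*} [NormedAddCommGroup E] [NormedSpace ℝ E]

/-- The estimates on the straightened state and its velocity with a constant `C`, valid for
controls bounded by `M` as soon as the primitive `s` of the first control and the state `z` are of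
size at most `δ`. -/
structure UniformEstimates (f₀ f₁ f₂ : E → E) (Q : E →L[ℝ] E) (φ : E →L[ℝ] ℝ) (M C δ : ℝ) :
    Prop where
  velocity : ∀ v w : ℝ, ∀ z : E, |v| ≤ M → |w| ≤ M → ‖z‖ ≤ δ →
    ‖f₀ z + v • f₂ z + w • f₁ z‖ ≤ C
  sub_state : ∀ s : ℝ, ∀ z : E, |s| ≤ δ → ‖z‖ ≤ δ → ‖straighten f₁ s z - z‖ ≤ C * |s|
  sub_one : ∀ s : ℝ, ∀ z : E, |s| ≤ δ → ‖z‖ ≤ δ →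
    ‖straighten f₁ s z - (z - s • f₁ 0)‖ ≤ C * (|s| + ‖z‖) ^ 2
  vel : ∀ v w s : ℝ, ∀ z : E, |v| ≤ M → |w| ≤ M → |s| ≤ δ → ‖z‖ ≤ δ →
    ‖straightenVel f₁ w s z (f₀ z + v • f₂ z)‖ ≤ C * (‖straighten f₁ s z‖ + |s|)
  map_vel : ∀ v w s : ℝ, ∀ z : E, |v| ≤ M → |w| ≤ M → |s| ≤ δ → ‖z‖ ≤ δ →
    ‖Q (straightenVel f₁ w s z (f₀ z + v • f₂ z))‖ ≤
      C * (‖Q (straighten f₁ s z)‖ + (‖straighten f₁ s z‖ ^ 2 + s ^ 2))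
  functional_vel : ∀ v w s : ℝ, ∀ z : E, |v| ≤ M → |w| ≤ M → |s| ≤ δ → ‖z‖ ≤ δ →
    |φ (straightenVel f₁ w s z (f₀ z + v • f₂ z)) + s ^ 2 / 2 *
      φ (lieBracket ℝ f₁ (lieBracket ℝ f₀ f₁) 0 + v • lieBracket ℝ f₁ (lieBracket ℝ f₂ f₁) 0)| ≤
      C * (‖Q (straighten f₁ s z)‖ + |s| * ‖straighten f₁ s z‖ + ‖straighten f₁ s z‖ ^ 2
        + (|s| + ‖z‖) ^ 3)

theorem exists_uniformEstimates {f₀ f₁ f₂ : E → E} (hf₀ : ContDiff ℝ (⊤ : ℕ∞) f₀)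
    (hf₁ : ContDiff ℝ (⊤ : ℕ∞) f₁) (hf₂ : ContDiff ℝ (⊤ : ℕ∞) f₂) (h0 : f₀ 0 = 0)
    (h2 : f₂ 0 = 0) {Q : E →L[ℝ] E} {φ : E →L[ℝ] ℝ} (hQ : Q (f₁ 0) = 0)
    (hQ₀ : ∀ x, Q (fderiv ℝ f₀ 0 x) = Q (fderiv ℝ f₀ 0 (Q x)))
    (hQ₂ : ∀ x, Q (fderiv ℝ f₂ 0 x) = Q (fderiv ℝ f₂ 0 (Q x)))
    (hφ₀ : ∀ x, φ (fderiv ℝ f₀ 0 x) = φ (fderiv ℝ f₀ 0 (Q x)))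
    (hφ₂ : ∀ x, φ (fderiv ℝ f₂ 0 x) = φ (fderiv ℝ f₂ 0 (Q x))) {M : ℝ} (hM : 0 ≤ M) :
    ∃ C δ : ℝ, 1 ≤ C ∧ 0 < δ ∧ UniformEstimates f₀ f₁ f₂ Q φ M C δ := by
  set l : Filter ((ℝ × ℝ) × ℝ × E) := 𝓟 (Metric.closedBall 0 M) ×ˢ 𝓝 0 with hl
  have hbd : ∀ᶠ m : (ℝ × ℝ) × ℝ × E in l, ‖m.1‖ ≤ M := by
    have : ∀ᶠ c : ℝ × ℝ in 𝓟 (Metric.closedBall (0 : ℝ × ℝ) M), ‖c‖ ≤ M := by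
      simp [eventually_principal]
    exact tendsto_fst.eventually this
  have hsnd : Tendsto (fun m : (ℝ × ℝ) × ℝ × E => m.2) l (𝓝 0) := tendsto_snd
  have h : SmallFamily l (fun m => m.1.1) (fun m => m.1.2) (fun m => m.2.1) (fun m => m.2.2) :=
    { bdd_v := IsBigO.of_bound M (hbd.mono fun m hm => by
        simpa using (norm_fst_le m.1).trans hm)
      bdd_w := IsBigO.of_bound M (hbd.mono fun m hm => by
        simpa using (norm_snd_le m.1).trans hm)
      tendsto_s := (continuous_fst.tendsto (0 : ℝ × E)).comp hsnd
      tendsto_z := (continuous_snd.tendsto (0 : ℝ × E)).comp hsnd }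
  have n : ∀ m : (ℝ × ℝ) × ℝ × E, 0 ≤ size (fun m : (ℝ × ℝ) × ℝ × E => m.2.1) (fun m => m.2.2) m :=
    fun m => by unfold size; positivity
  have e1 := exists_bound_of_isBigO (((h.pow_le (Nat.zero_le _)
    (h.drift_isBigO hf₀ hf₂ h0 h2)).add (isBigO_smul_pow h.bdd_w' (h.bdd_comp hf₁.continuous))))
    (fun m => pow_nonneg (n m) _)
  have e2 := exists_bound_of_isBigO (h.straighten_sub_state hf₁).norm_right
    (fun m => norm_nonneg _)
  have e3 := exists_bound_of_isBigO (h.straighten_sub_one hf₁) (fun m => pow_nonneg (n m) _)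
  have e4 := exists_bound_of_isBigO (h.straightenVel_isBigO hf₀ hf₁ hf₂ h0 h2)
    (fun m => by positivity)
  have e5 := exists_bound_of_isBigO (h.map_straightenVel_isBigO hf₀ hf₁ hf₂ h0 h2 hQ hQ₀ hQ₂)
    (fun m => by positivity)
  have e6 := exists_bound_of_isBigO
    (h.map_straightenVel_add_quadCoeff_isBigO hf₀ hf₁ hf₂ h0 h2 hQ hφ₀ hφ₂)
    (fun m => add_nonneg (by positivity) (pow_nonneg (n m) _))
  obtain ⟨C, hC, e1, e2, e3, e4, e5, e6⟩ := ((eventually_ge_atTop (1 : ℝ)).and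
    (e1.and (e2.and (e3.and (e4.and (e5.and e6)))))).exists
  obtain ⟨δ, hδ, e1, e2, e3, e4, e5, e6⟩ := ((eventually_mem_nhdsWithin (a := (0 : ℝ))
    (s := Ioi 0)).and (e1.and (e2.and (e3.and (e4.and (e5.and e6)))))).exists
  have hδ0 : |(0 : ℝ)| ≤ δ := by simpa using (le_of_lt hδ : (0 : ℝ) ≤ δ)
  have hM0 : |(0 : ℝ)| ≤ M := by simpa using hM
  refine ⟨C, δ, hC, hδ, ⟨fun v w z hv hw hz => ?_, fun s z hs hz => ?_, fun s z hs hz => ?_,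
    e4, e5, fun v w s z hv hw hs hz => ?_⟩⟩
  · simpa using e1 v w 0 z hv hw hδ0 hz
  · simpa using e2 0 0 s z hM0 hM0 hs hz
  · simpa [size] using e3 0 0 s z hM0 hM0 hs hz
  · have := e6 v w s z hv hw hs hz
    rw [SmallFamily.quadCoeff_eq hf₀ hf₁ hf₂ h0 h2] at this
    simpa only [size, Real.norm_eq_abs] using this

end Uniform

/-! ### Integration along Lipschitz curves -/

section Integration

/-- An absolutely continuous function grows at least by the integral of a lower bound of its
derivative. -/
theorem integral_le_sub_of_ae_hasDerivAt {T : ℝ} (hT : 0 ≤ T) {x x' r : ℝ → ℝ}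
    (hx : AbsolutelyContinuousOnInterval x 0 T) (hr : ContinuousOn r (Icc 0 T))
    (hd : ∀ᵐ t, t ∈ Icc 0 T → HasDerivAt x (x' t) t) (hle : ∀ᵐ t, t ∈ Icc 0 T → r t ≤ x' t) :
    ∫ t in (0 : ℝ)..T, r t ≤ x T - x 0 := by
  rw [← hx.integral_deriv_eq_sub]
  refine intervalIntegral.integral_mono_ae_restrict hT (hr.intervalIntegrable_of_Icc hT)
    hx.intervalIntegrable_deriv ?_
  rw [EventuallyLE, ae_restrict_iff' measurableSet_Icc]
  filter_upwards [hd, hle] with t h1 h2 ht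
  rw [(h1 ht).deriv]
  exact h2 ht

variable {E : Type*} [NormedAddCommGroup E] [NormedSpace ℝ E]

theorem norm_sub_le_integral_of_ae_hasDerivAt {T : ℝ} (hT : 0 ≤ T) {x x' : ℝ → E} {r : ℝ → ℝ}
    {K : NNReal} (hx : LipschitzOnWith K x (Icc 0 T)) (hr : ContinuousOn r (Icc 0 T))
    (hd : ∀ᵐ t, t ∈ Icc 0 T → HasDerivAt x (x' t) t) (hle : ∀ᵐ t, t ∈ Icc 0 T → ‖x' t‖ ≤ r t) :
    ‖x T - x 0‖ ≤ ∫ t in (0 : ℝ)..T, r t := by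
  -- the fundamental theorem of calculus is applied after a norming functional
  obtain ⟨g, hg, hgx⟩ := exists_dual_vector'' ℝ (x T - x 0)
  have hlip : LipschitzOnWith (‖-g‖₊ * K) (fun t => (-g) (x t)) (Icc 0 T) :=
    (-g).lipschitz.comp_lipschitzOnWith hx
  have := integral_le_sub_of_ae_hasDerivAt hT (x := fun t => (-g) (x t))
    (x' := fun t => (-g) (x' t)) (r := fun t => - r t)
    (by rw [← uIcc_of_le hT] at hlip; exact hlip.absolutelyContinuousOnInterval) hr.neg
    (hd.mono fun t h ht => (-g).hasFDerivAt.comp_hasDerivAt t (h ht))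
    (hle.mono fun t h ht => by
      have h1 : ‖g (x' t)‖ ≤ r t := (g.le_of_opNorm_le hg _).trans (by simpa using h ht)
      have h2 := (abs_le.1 (Real.norm_eq_abs _ ▸ h1)).2
      simpa using h2)
  rw [map_sub] at hgx
  simp only [intervalIntegral.integral_neg, neg_apply] at this
  have hgx' : g (x T) - g (x 0) = ‖x T - x 0‖ := by simpa using hgx
  linarith

/-- Cauchy-Schwarz for the integral of a continuous function against `1`. -/
theorem sq_integral_abs_le {T : ℝ} (hT : 0 < T) {s : ℝ → ℝ} (hs : ContinuousOn s (Icc 0 T)) :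
    (∫ t in (0 : ℝ)..T, |s t|) ^ 2 ≤ T * ∫ t in (0 : ℝ)..T, s t ^ 2 := by
  set J := ∫ t in (0 : ℝ)..T, |s t| with hJ
  have h1 : IntervalIntegrable (fun t => |s t|) volume 0 T :=
    (hs.abs).intervalIntegrable_of_Icc hT.le
  have h2 : IntervalIntegrable (fun t => s t ^ 2) volume 0 T :=
    (hs.pow 2).intervalIntegrable_of_Icc hT.le
  have h0 : 0 ≤ ∫ t in (0 : ℝ)..T, (|s t| - J / T) ^ 2 :=
    intervalIntegral.integral_nonneg hT.le fun t _ => sq_nonneg _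
  have e : ∀ t, (|s t| - J / T) ^ 2 = s t ^ 2 - 2 * (J / T) * |s t| + (J / T) ^ 2 := fun t => by
    rw [sub_sq, sq_abs]; ring
  simp only [e] at h0
  rw [intervalIntegral.integral_add (h2.sub (h1.const_mul _)) (by simp),
    intervalIntegral.integral_sub h2 (h1.const_mul _), intervalIntegral.integral_const_mul,
    ← hJ, intervalIntegral.integral_const, smul_eq_mul, sub_zero] at h0
  have : (∫ t in (0 : ℝ)..T, s t ^ 2) - 2 * (J / T) * J + T * (J / T) ^ 2
      = (∫ t in (0 : ℝ)..T, s t ^ 2) - J ^ 2 / T := by field_simp; ring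
  rw [this, sub_nonneg, div_le_iff₀ hT] at h0
  linarith

end Integration

/-! ### Coercivity along trajectories -/

section Coercivity

theorem eventually_mul_le (a : ℝ) {b : ℝ} (hb : 0 < b) : ∀ᶠ T : ℝ in 𝓝[>] 0, a * T ≤ b := by
  have : Tendsto (fun T : ℝ => a * T) (𝓝[>] 0) (𝓝 0) := by
    have := ((continuous_const_mul a).tendsto 0).mono_left (nhdsWithin_le_nhds (s := Ioi 0))
    simpa using this
  exact (this.eventually (gt_mem_nhds hb)).mono fun T hT => hT.le

/-- Short-time Gronwall inequality, in a form where the bound does not depend on time. -/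
theorem norm_le_of_ae_hasDerivAt_of_small {F : Type*} [NormedAddCommGroup F] [NormedSpace ℝ F]
    {T C : ℝ} (hT : 0 ≤ T) (hC : 0 ≤ C) (hCT : C * T ≤ 1 / 2) {y y' : ℝ → F} {r : ℝ → ℝ}
    {K : NNReal} (hy : LipschitzOnWith K y (Icc 0 T)) (hy0 : y 0 = 0)
    (hr : ContinuousOn r (Icc 0 T)) (hr0 : ∀ t, 0 ≤ r t)
    (hd : ∀ᵐ t, t ∈ Icc 0 T → HasDerivAt y (y' t) t)
    (hle : ∀ᵐ t, t ∈ Icc 0 T → ‖y' t‖ ≤ C * (‖y t‖ + r t)) {t : ℝ} (ht : t ∈ Icc 0 T) :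
    ‖y t‖ ≤ 2 * C * ∫ t in (0 : ℝ)..T, r t := by
  obtain ⟨t₀, ht₀, hmax⟩ := isCompact_Icc.exists_isMaxOn (nonempty_Icc.2 hT) hy.continuousOn.norm
  have hmax' : ∀ t ∈ Icc 0 T, ‖y t‖ ≤ ‖y t₀‖ := hmax
  refine (hmax' t ht).trans ?_
  set A := ‖y t₀‖
  have hsub : Icc 0 t₀ ⊆ Icc 0 T := Icc_subset_Icc_right ht₀.2
  have hri : IntervalIntegrable r volume 0 T := hr.intervalIntegrable_of_Icc hT
  have hA : 0 ≤ A := norm_nonneg _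
  have hcont : ContinuousOn (fun t => C * (A + r t)) (Icc 0 T) :=
    continuousOn_const.mul (continuousOn_const.add hr)
  have h1 := norm_sub_le_integral_of_ae_hasDerivAt ht₀.1 (hy.mono hsub)
    (r := fun t => C * (A + r t)) (hcont.mono hsub)
    (hd.mono fun t h ht => h (hsub ht))
    (by
      filter_upwards [hle] with t h ht
      refine (h (hsub ht)).trans ?_
      gcongr
      exact hmax' t (hsub ht))
  have h2 : ∫ t in (0 : ℝ)..t₀, C * (A + r t) ≤ ∫ t in (0 : ℝ)..T, C * (A + r t) :=
    intervalIntegral.integral_mono_interval le_rfl ht₀.1 ht₀.2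
      (Eventually.of_forall fun t => mul_nonneg hC (add_nonneg hA (hr0 t)))
      (hcont.intervalIntegrable_of_Icc hT)
  have h3 : ∫ t in (0 : ℝ)..T, C * (A + r t) = C * (T * A + ∫ t in (0 : ℝ)..T, r t) := by
    rw [intervalIntegral.integral_const_mul, intervalIntegral.integral_add (by simp) hri]
    simp
  rw [hy0, sub_zero] at h1
  have h4 : A ≤ C * (T * A + ∫ t in (0 : ℝ)..T, r t) := h1.trans (h2.trans h3.le)
  nlinarith

variable {E : Type*} [NormedAddCommGroup E] [NormedSpace ℝ E]

/-- `z` is a trajectory on `[0, T]` of `z' = f₀(z) + w f₁(z) + v f₂(z)` issued from the origin,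
with `|v|, |w| ≤ M`, `s` is the primitive of `w`, the pair `(s, z)` stays of size `κ T`, and the
control `v` keeps the bracket `[f₁, [f₀ + v f₂, f₁]](0)` on the negative side of `φ`. -/
structure IsTrajectory (f₀ f₁ f₂ : E → E) (φ : E →L[ℝ] ℝ) (M κ T : ℝ) (v w s : ℝ → ℝ)
    (z : ℝ → E) : Prop where
  lipschitz_s : ∃ K, LipschitzOnWith K s (Icc 0 T)
  lipschitz_z : ∃ K, LipschitzOnWith K z (Icc 0 T)
  s_zero : s 0 = 0
  z_zero : z 0 = 0
  bound : ∀ t ∈ Icc 0 T, |s t| + ‖z t‖ ≤ κ * T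
  v_le : ∀ᵐ t, t ∈ Icc 0 T → |v t| ≤ M
  w_le : ∀ᵐ t, t ∈ Icc 0 T → |w t| ≤ M
  negative : ∀ᵐ t, t ∈ Icc 0 T → φ (lieBracket ℝ f₁ (lieBracket ℝ f₀ f₁) 0
    + v t • lieBracket ℝ f₁ (lieBracket ℝ f₂ f₁) 0) ≤ -1 / 2
  hasDerivAt_s : ∀ᵐ t, t ∈ Icc 0 T → HasDerivAt s (w t) t
  hasDerivAt_z : ∀ᵐ t, t ∈ Icc 0 T →
    HasDerivAt z (f₀ (z t) + v t • f₂ (z t) + w t • f₁ (z t)) t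

namespace IsTrajectory

variable {f₀ f₁ f₂ : E → E} {Q : E →L[ℝ] E} {φ : E →L[ℝ] ℝ} {M C κ δ T : ℝ} {v w s : ℝ → ℝ}
  {z : ℝ → E}

theorem exists_lipschitz (h : IsTrajectory f₀ f₁ f₂ φ M κ T v w s z)
    (hf₁ : ContDiff ℝ (⊤ : ℕ∞) f₁) :
    ∃ K, LipschitzOnWith K (fun t => straighten f₁ (s t) (z t)) (Icc 0 T) := by
  obtain ⟨K₁, h₁⟩ := h.lipschitz_s
  obtain ⟨K₂, h₂⟩ := h.lipschitz_z
  have h3 : LipschitzOnWith (max K₁ K₂) (fun t => (s t, z t)) (Icc 0 T) := h₁.prodMk h₂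
  have hp := contDiff_dirDeriv hf₁ hf₁
  have hq := contDiff_dirDeriv hf₁ hp
  have hsm : ContDiff ℝ (⊤ : ℕ∞) (fun m : ℝ × E => straighten f₁ m.1 m.2) := by
    unfold straighten
    fun_prop
  obtain ⟨K, hK⟩ := ((hsm.of_le (by simp)).locallyLipschitz.locallyLipschitzOn
    (s := (fun t => (s t, z t)) '' Icc 0 T)).exists_lipschitzOnWith_of_compact
      (isCompact_Icc.image_of_continuousOn h3.continuousOn)
  exact ⟨K * max K₁ K₂, hK.comp h3 (mapsTo_image _ _)⟩

theorem straighten_zero (h : IsTrajectory f₀ f₁ f₂ φ M κ T v w s z) :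
    straighten f₁ (s 0) (z 0) = 0 := by
  simp [h.s_zero, h.z_zero, straighten]

theorem ae_hasDerivAt (h : IsTrajectory f₀ f₁ f₂ φ M κ T v w s z)
    (hf₁ : ContDiff ℝ (⊤ : ℕ∞) f₁) :
    ∀ᵐ t, t ∈ Icc 0 T → HasDerivAt (fun t => straighten f₁ (s t) (z t))
      (straightenVel f₁ (w t) (s t) (z t) (f₀ (z t) + v t • f₂ (z t))) t := by
  filter_upwards [h.hasDerivAt_s, h.hasDerivAt_z] with t h1 h2 ht
  exact hasDerivAt_straighten hf₁ (h1 ht) (h2 ht)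

theorem s_le (h : IsTrajectory f₀ f₁ f₂ φ M κ T v w s z) (hδ : κ * T ≤ δ) {t : ℝ}
    (ht : t ∈ Icc 0 T) : |s t| ≤ δ := by
  linarith [h.bound t ht, norm_nonneg (z t)]

theorem z_le (h : IsTrajectory f₀ f₁ f₂ φ M κ T v w s z) (hδ : κ * T ≤ δ) {t : ℝ}
    (ht : t ∈ Icc 0 T) : ‖z t‖ ≤ δ := by
  linarith [h.bound t ht, abs_nonneg (s t)]

theorem continuousOn_s (h : IsTrajectory f₀ f₁ f₂ φ M κ T v w s z) : ContinuousOn s (Icc 0 T) :=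
  h.lipschitz_s.choose_spec.continuousOn

theorem norm_straighten_le (h : IsTrajectory f₀ f₁ f₂ φ M κ T v w s z)
    (hE : UniformEstimates f₀ f₁ f₂ Q φ M C δ) (hf₁ : ContDiff ℝ (⊤ : ℕ∞) f₁)
    (hT : 0 ≤ T) (hC : 0 ≤ C) (hCT : C * T ≤ 1 / 2) (hδ : κ * T ≤ δ) {t : ℝ}
    (ht : t ∈ Icc 0 T) :
    ‖straighten f₁ (s t) (z t)‖ ≤ 2 * C * ∫ t in (0 : ℝ)..T, |s t| := by
  obtain ⟨K, hK⟩ := h.exists_lipschitz hf₁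
  refine norm_le_of_ae_hasDerivAt_of_small hT hC hCT hK h.straighten_zero
    h.continuousOn_s.abs (fun t => abs_nonneg _) (h.ae_hasDerivAt hf₁) ?_ ht
  filter_upwards [h.v_le, h.w_le] with t h1 h2 ht
  exact hE.vel _ _ _ _ (h1 ht) (h2 ht) (h.s_le hδ ht) (h.z_le hδ ht)

theorem norm_map_straighten_le (h : IsTrajectory f₀ f₁ f₂ φ M κ T v w s z)
    (hE : UniformEstimates f₀ f₁ f₂ Q φ M C δ) (hf₁ : ContDiff ℝ (⊤ : ℕ∞) f₁)
    (hT : 0 ≤ T) (hC : 0 ≤ C) (hCT : C * T ≤ 1 / 2) (hδ : κ * T ≤ δ) {t : ℝ}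
    (ht : t ∈ Icc 0 T) :
    ‖Q (straighten f₁ (s t) (z t))‖ ≤
      2 * C * (T * (2 * C * ∫ t in (0 : ℝ)..T, |s t|) ^ 2 + ∫ t in (0 : ℝ)..T, s t ^ 2) := by
  obtain ⟨K, hK⟩ := h.exists_lipschitz hf₁
  set A := 2 * C * ∫ t in (0 : ℝ)..T, |s t|
  have hs2 : ContinuousOn (fun t => s t ^ 2) (Icc 0 T) := h.continuousOn_s.pow 2
  have key := norm_le_of_ae_hasDerivAt_of_small hT hC hCT (Q.lipschitz.comp_lipschitzOnWith hK)
    (by simp [Function.comp, h.straighten_zero]) (r := fun t => A ^ 2 + s t ^ 2)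
    (continuousOn_const.add hs2) (fun t => by positivity)
    ((h.ae_hasDerivAt hf₁).mono fun t ht' ht => Q.hasFDerivAt.comp_hasDerivAt t (ht' ht)) ?_ ht
  · rwa [intervalIntegral.integral_add (by simp) (hs2.intervalIntegrable_of_Icc hT),
      intervalIntegral.integral_const, smul_eq_mul, sub_zero] at key
  · filter_upwards [h.v_le, h.w_le] with t h1 h2 ht
    refine (hE.map_vel _ _ _ _ (h1 ht) (h2 ht) (h.s_le hδ ht) (h.z_le hδ ht)).trans ?_
    gcongr
    · rfl
    · exact h.norm_straighten_le hE hf₁ hT hC hCT hδ ht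

/-- Along a trajectory, `φ` of the straightened state dominates the integral of `s²`. -/
theorem integral_sq_le (h : IsTrajectory f₀ f₁ f₂ φ M κ T v w s z)
    (hE : UniformEstimates f₀ f₁ f₂ Q φ M C δ) (hf₁ : ContDiff ℝ (⊤ : ℕ∞) f₁)
    (hT : 0 < T) (hT1 : T ≤ 1) (hC : 0 ≤ C) (hκ : 0 ≤ κ) (hCT : C * T ≤ 1 / 2)
    (hδ : κ * T ≤ δ) :
    (1 / 4 - (2 * C * κ * (1 + C) ^ 2 + 2 * C ^ 2 + 2 * C ^ 2 * (4 * C ^ 2 + 1) + 4 * C ^ 3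
      + 8 * κ * C ^ 3) * T) * ∫ t in (0 : ℝ)..T, s t ^ 2 ≤ φ (straighten f₁ (s T) (z T)) := by
  obtain ⟨K, hK⟩ := h.exists_lipschitz hf₁
  set J := ∫ t in (0 : ℝ)..T, |s t| with hJ
  set I := ∫ t in (0 : ℝ)..T, s t ^ 2 with hI
  set A := 2 * C * J with hA
  set B := 2 * C * (T * A ^ 2 + I) with hB
  have hJ0 : 0 ≤ J := intervalIntegral.integral_nonneg hT.le fun t _ => abs_nonneg _
  have hI0 : 0 ≤ I := intervalIntegral.integral_nonneg hT.le fun t _ => sq_nonneg _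
  have hA0 : 0 ≤ A := by positivity
  have hJI : J ^ 2 ≤ T * I := sq_integral_abs_le hT h.continuousOn_s
  have hs1 : IntervalIntegrable (fun t => |s t|) volume 0 T :=
    h.continuousOn_s.abs.intervalIntegrable_of_Icc hT.le
  have hs2 : IntervalIntegrable (fun t => s t ^ 2) volume 0 T :=
    (h.continuousOn_s.pow 2).intervalIntegrable_of_Icc hT.le
  set c₂ := 1 / 4 - C * (κ * T * (2 * (1 + C) ^ 2)) with hc₂
  set c₀ := C * (B + A ^ 2 + κ * T * (2 * A ^ 2)) with hc₀
  have hlip := φ.lipschitz.comp_lipschitzOnWith hK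
  rw [← uIcc_of_le hT.le] at hlip
  have key := integral_le_sub_of_ae_hasDerivAt hT.le
    (r := fun t => c₂ * s t ^ 2 - C * A * |s t| - c₀) hlip.absolutelyContinuousOnInterval
    (((continuousOn_const.mul (h.continuousOn_s.pow 2)).sub
      (continuousOn_const.mul h.continuousOn_s.abs)).sub continuousOn_const)
    ((h.ae_hasDerivAt hf₁).mono fun t ht' ht => φ.hasFDerivAt.comp_hasDerivAt t (ht' ht)) ?_
  · have e : (φ ∘ fun t => straighten f₁ (s t) (z t)) T - (φ ∘ fun t => straighten f₁ (s t) (z t)) 0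
        = φ (straighten f₁ (s T) (z T)) := by
      simp [Function.comp, h.straighten_zero]
    rw [e, intervalIntegral.integral_sub ((hs2.const_mul _).sub (hs1.const_mul _)) (by simp),
      intervalIntegral.integral_sub (hs2.const_mul _) (hs1.const_mul _),
      intervalIntegral.integral_const_mul, intervalIntegral.integral_const_mul,
      intervalIntegral.integral_const, smul_eq_mul, sub_zero, ← hJ, ← hI] at key
    refine le_trans ?_ key
    have hA2 : A ^ 2 ≤ 4 * C ^ 2 * (T * I) := by
      rw [hA, mul_pow, mul_pow]
      nlinarith [mul_le_mul_of_nonneg_left hJI (by positivity : 0 ≤ 4 * C ^ 2)]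
    have hTI : T * I ≤ I := mul_le_of_le_one_left hI0 hT1
    have hA2' : A ^ 2 ≤ 4 * C ^ 2 * I := hA2.trans (by gcongr)
    have hTA : T * A ^ 2 ≤ 4 * C ^ 2 * I :=
      (mul_le_of_le_one_left (by positivity) hT1).trans hA2'
    have b1 : C * A * J ≤ 2 * C ^ 2 * (T * I) := by
      rw [hA]
      nlinarith [mul_le_mul_of_nonneg_left hJI (by positivity : 0 ≤ 2 * C ^ 2)]
    have b2 : T * (C * B) ≤ 2 * C ^ 2 * (4 * C ^ 2 + 1) * (T * I) := by
      have : C * B ≤ 2 * C ^ 2 * (4 * C ^ 2 + 1) * I := by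
        calc C * B = 2 * C ^ 2 * (T * A ^ 2 + I) := by rw [hB]; ring
          _ ≤ 2 * C ^ 2 * (4 * C ^ 2 * I + I) := by gcongr
          _ = _ := by ring
      calc T * (C * B) ≤ T * (2 * C ^ 2 * (4 * C ^ 2 + 1) * I) := by gcongr
        _ = _ := by ring
    have b3 : T * (C * A ^ 2) ≤ 4 * C ^ 3 * (T * I) := by
      calc T * (C * A ^ 2) ≤ T * (C * (4 * C ^ 2 * I)) := by gcongr
        _ = _ := by ring
    have b4 : T * (C * (κ * T * (2 * A ^ 2))) ≤ 8 * κ * C ^ 3 * (T * I) := by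
      calc T * (C * (κ * T * (2 * A ^ 2))) = T * (2 * C * κ * (T * A ^ 2)) := by ring
        _ ≤ T * (2 * C * κ * (4 * C ^ 2 * I)) := by gcongr
        _ = _ := by ring
    rw [hc₂, hc₀]
    linarith
  · filter_upwards [h.v_le, h.w_le, h.negative] with t h1 h2 h3 ht
    have hs := h.s_le hδ ht
    have hz := h.z_le hδ ht
    have e1 := (abs_le.1 (hE.functional_vel _ _ _ _ (h1 ht) (h2 ht) hs hz)).1
    have e2 := h.norm_straighten_le hE hf₁ hT.le hC hCT hδ ht
    have e3 := h.norm_map_straighten_le hE hf₁ hT.le hC hCT hδ ht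
    rw [← hJ, ← hA] at e2
    rw [← hJ, ← hA, ← hI, ← hB] at e3
    have e4 := hE.sub_state _ _ hs hz
    have e5 : ‖z t‖ ≤ A + C * |s t| := by
      have : ‖z t‖ ≤ ‖straighten f₁ (s t) (z t)‖ + ‖straighten f₁ (s t) (z t) - z t‖ := by
        simpa using norm_sub_le (straighten f₁ (s t) (z t)) (straighten f₁ (s t) (z t) - z t)
      linarith
    have e6 : (|s t| + ‖z t‖) ^ 3 ≤ κ * T * (2 * A ^ 2 + 2 * (1 + C) ^ 2 * s t ^ 2) := by
      have i1 : (|s t| + ‖z t‖) ^ 2 ≤ (A + (1 + C) * |s t|) ^ 2 := by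
        refine pow_le_pow_left₀ (by positivity) ?_ 2
        linarith
      have i2 : (A + (1 + C) * |s t|) ^ 2 ≤ 2 * A ^ 2 + 2 * (1 + C) ^ 2 * s t ^ 2 := by
        rw [← sq_abs (s t)]
        nlinarith [sq_nonneg (A - (1 + C) * |s t|)]
      calc (|s t| + ‖z t‖) ^ 3 = (|s t| + ‖z t‖) * (|s t| + ‖z t‖) ^ 2 := by ring
        _ ≤ κ * T * (2 * A ^ 2 + 2 * (1 + C) ^ 2 * s t ^ 2) := by
          gcongr
          · exact h.bound t ht
          · exact i1.trans i2
    have e7 : C * (‖Q (straighten f₁ (s t) (z t))‖ + |s t| * ‖straighten f₁ (s t) (z t)‖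
        + ‖straighten f₁ (s t) (z t)‖ ^ 2 + (|s t| + ‖z t‖) ^ 3) ≤
        C * (B + |s t| * A + A ^ 2 + κ * T * (2 * A ^ 2 + 2 * (1 + C) ^ 2 * s t ^ 2)) := by
      gcongr
    have e8 := mul_le_mul_of_nonneg_left (h3 ht) (by positivity : 0 ≤ s t ^ 2 / 2)
    rw [hc₂, hc₀]
    linarith

/-- The end point of a trajectory in small time lies, up to a quadratic error, on the
nonnegative side of `φ`. -/
theorem eventually_nonneg (hE : UniformEstimates f₀ f₁ f₂ Q φ M C δ)
    (hf₁ : ContDiff ℝ (⊤ : ℕ∞) f₁) (hC : 1 ≤ C) (hδ : 0 < δ) (hκ : 0 ≤ κ) (hf₁0 : f₁ 0 ≠ 0)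
    (hφ : φ (f₁ 0) = 0) :
    ∃ D : ℝ, 0 ≤ D ∧ ∀ᶠ T : ℝ in 𝓝[>] 0, ∀ (v w s : ℝ → ℝ) (z : ℝ → E),
      IsTrajectory f₀ f₁ f₂ φ M κ T v w s z → 0 ≤ φ (z T) + D * ‖z T‖ ^ 2 := by
  have hb : 0 < ‖f₁ 0‖ := norm_pos_iff.2 hf₁0
  set b := ‖f₁ 0‖ with hb'
  set β := 1 + 4 / b with hβ
  have hβ0 : 0 ≤ β := by positivity
  set D₁ := (2 * C * κ * (1 + C) ^ 2 + 2 * C ^ 2 + 2 * C ^ 2 * (4 * C ^ 2 + 1) + 4 * C ^ 3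
      + 8 * κ * C ^ 3) with hD₁
  have hC0 : 0 ≤ C := by linarith
  refine ⟨‖φ‖ * C * (2 * β ^ 2), by positivity, ?_⟩
  filter_upwards [eventually_mem_nhdsWithin, eventually_mul_le 1 one_pos, eventually_mul_le κ hδ,
    eventually_mul_le C (by norm_num : (0 : ℝ) < 1 / 2), eventually_mul_le (C * κ) one_pos,
    eventually_mul_le (C * κ) (half_pos hb),
    eventually_mul_le (D₁ + ‖φ‖ * C * (2 * β ^ 2) * (4 * C ^ 2)) (by norm_num : (0 : ℝ) < 1 / 4)]
    with T hT hT1 hTδ hTC hTκ hTb hTD v w s z h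
  have hT : 0 < T := hT
  rw [one_mul] at hT1
  have hTm : T ∈ Icc 0 T := ⟨hT.le, le_rfl⟩
  have main := h.integral_sq_le hE hf₁ hT hT1 hC0 hκ hTC hTδ
  have hX := h.norm_straighten_le hE hf₁ hT.le hC0 hTC hTδ hTm
  have hJI : (∫ t in (0 : ℝ)..T, |s t|) ^ 2 ≤ T * ∫ t in (0 : ℝ)..T, s t ^ 2 :=
    sq_integral_abs_le hT h.continuousOn_s
  have hJ0 : 0 ≤ ∫ t in (0 : ℝ)..T, |s t| :=
    intervalIntegral.integral_nonneg hT.le fun t _ => abs_nonneg _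
  have hI0 : 0 ≤ ∫ t in (0 : ℝ)..T, s t ^ 2 :=
    intervalIntegral.integral_nonneg hT.le fun t _ => sq_nonneg _
  set J := ∫ t in (0 : ℝ)..T, |s t|
  set I := ∫ t in (0 : ℝ)..T, s t ^ 2
  set x := straighten f₁ (s T) (z T)
  have hone := hE.sub_one _ _ (h.s_le hTδ hTm) (h.z_le hTδ hTm)
  have hbound := h.bound T hTm
  set A := 2 * C * J
  set m := ‖z T‖
  set σ := |s T|
  have hm0 : 0 ≤ m := norm_nonneg _
  have hσ0 : 0 ≤ σ := abs_nonneg _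
  have hA0 : 0 ≤ A := by positivity
  have hA2 : A ^ 2 ≤ 4 * C ^ 2 * (T * I) := by
    calc A ^ 2 = 4 * C ^ 2 * J ^ 2 := by ring
      _ ≤ _ := by gcongr
  -- the size of `s T` is recovered from the end point and the straightened state
  have hσ : σ + m ≤ β * (m + A) := by
    have i1 : σ * b ≤ ‖x - (z T - s T • f₁ 0)‖ + ‖z T‖ + ‖x‖ := by
      have : s T • f₁ 0 = (x - (z T - s T • f₁ 0)) + z T - x := by abel
      calc σ * b = ‖s T • f₁ 0‖ := by rw [norm_smul, Real.norm_eq_abs]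
        _ = ‖(x - (z T - s T • f₁ 0)) + z T - x‖ := by rw [← this]
        _ ≤ _ := (norm_sub_le _ _).trans (by gcongr; exact norm_add_le _ _)
    have i2 : C * (σ + m) ^ 2 ≤ C * κ * T * (σ + m) := by
      calc C * (σ + m) ^ 2 = C * ((σ + m) * (σ + m)) := by ring
        _ ≤ C * (κ * T * (σ + m)) := by gcongr
        _ = _ := by ring
    have i3 : C * κ * T * (σ + m) ≤ b / 2 * σ + m := by
      nlinarith [mul_le_mul_of_nonneg_right hTb hσ0, mul_le_mul_of_nonneg_right hTκ hm0]
    have i4 : σ * b ≤ 4 * (m + A) := by linarith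
    have i5 : σ ≤ 4 / b * (m + A) := by
      rw [div_mul_eq_mul_div, le_div_iff₀ hb]
      exact i4
    rw [hβ]
    linarith
  have hφx : φ x - φ (z T) ≤ ‖φ‖ * C * (σ + m) ^ 2 := by
    have : φ x - φ (z T) = φ (x - (z T - s T • f₁ 0)) := by simp [hφ]
    rw [this, mul_assoc]
    exact (le_abs_self _).trans ((φ.le_opNorm _).trans (by gcongr))
  have hsq : (σ + m) ^ 2 ≤ 2 * β ^ 2 * (m ^ 2 + A ^ 2) := by
    calc (σ + m) ^ 2 ≤ (β * (m + A)) ^ 2 := by gcongr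
      _ = β ^ 2 * (m + A) ^ 2 := by ring
      _ ≤ β ^ 2 * (2 * (m ^ 2 + A ^ 2)) := by
        gcongr
        nlinarith [sq_nonneg (m - A)]
      _ = _ := by ring
  have hfin : ‖φ‖ * C * (σ + m) ^ 2 ≤
      ‖φ‖ * C * (2 * β ^ 2) * m ^ 2 + ‖φ‖ * C * (2 * β ^ 2) * (4 * C ^ 2) * (T * I) := by
    calc ‖φ‖ * C * (σ + m) ^ 2 ≤ ‖φ‖ * C * (2 * β ^ 2 * (m ^ 2 + 4 * C ^ 2 * (T * I))) := by
          gcongr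
          exact hsq.trans (by gcongr)
      _ = _ := by ring
  have := mul_le_mul_of_nonneg_right hTD hI0
  linarith

end IsTrajectory
end Coercivity

/-! ### Carathéodory solutions as trajectories -/

section Solutions

theorem sum_control {n : ℕ} (f₀ f₁ f₂ : State n → State n) (u : Fin 2 → ℝ) (x : State n) :
    f₀ x + ∑ k, u k • (![f₁, f₂] : Fin 2 → State n → State n) k x =
      f₀ x + u 1 • f₂ x + u 0 • f₁ x := by
  simp [Fin.sum_univ_two]
  abel

variable {E : Type*} [NormedAddCommGroup E] [NormedSpace ℝ E]

theorem lipschitzOnWith_of_eq_integral {T C : ℝ} {x g : ℝ → E}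
    (hC : 0 ≤ C) (hg : IntervalIntegrable g volume 0 T)
    (hx : ∀ t ∈ Icc 0 T, x t = x 0 + ∫ r in (0 : ℝ)..t, g r)
    (hb : ∀ᵐ t, t ∈ Icc 0 T → ‖g t‖ ≤ C) : LipschitzOnWith C.toNNReal x (Icc 0 T) := by
  refine LipschitzOnWith.of_dist_le_mul fun a ha b hb' => ?_
  have hsub : ∀ t ∈ Icc 0 T, IntervalIntegrable g volume 0 t := fun t ht =>
    hg.mono_set (by rw [uIcc_of_le ht.1, uIcc_of_le (ht.1.trans ht.2)]
                    exact Icc_subset_Icc_right ht.2)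
  rw [dist_eq_norm, hx a ha, hx b hb', add_sub_add_left_eq_sub,
    intervalIntegral.integral_interval_sub_left (hsub a ha) (hsub b hb'), Real.dist_eq,
    Real.coe_toNNReal _ hC]
  refine intervalIntegral.norm_integral_le_of_norm_le_const_ae ?_
  filter_upwards [hb] with t ht hmem
  refine ht ?_
  have := uIoc_subset_uIcc hmem
  exact (uIcc_subset_Icc hb' ha) this

theorem ae_hasDerivAt_of_eq_integral [CompleteSpace E] {T : ℝ} (hT : 0 ≤ T) {x g : ℝ → E}
    (hg : IntervalIntegrable g volume 0 T)
    (hx : ∀ t ∈ Icc 0 T, x t = x 0 + ∫ r in (0 : ℝ)..t, g r) :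
    ∀ᵐ t, t ∈ Icc 0 T → HasDerivAt x (g t) t := by
  have h0 : ∀ᵐ t : ℝ, t ≠ 0 := by simp [ae_iff, measure_singleton]
  have h1 : ∀ᵐ t : ℝ, t ≠ T := by simp [ae_iff, measure_singleton]
  filter_upwards [hg.ae_hasDerivAt_integral, h0, h1] with t h h0 h1 ht
  have hd := (h (by rwa [uIcc_of_le hT]) 0 left_mem_uIcc).const_add (x 0)
  refine hd.congr_of_eventuallyEq ?_
  filter_upwards [Ioo_mem_nhds (lt_of_le_of_ne ht.1 h0.symm) (lt_of_le_of_ne ht.2 h1)] with r hr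
  exact hx r (Ioo_subset_Icc_self hr)

/-- A curve issued from `0` whose velocity is bounded by `C` inside the ball of radius `δ` cannot
leave that ball before time `δ / C`. -/
theorem norm_le_of_eq_integral {T C δ : ℝ} (hC : 0 ≤ C) (hCT : C * T < δ) {x g : ℝ → E}
    (hxc : ContinuousOn x (Icc 0 T)) (hx0 : x 0 = 0)
    (hx : ∀ t ∈ Icc 0 T, x t = x 0 + ∫ r in (0 : ℝ)..t, g r)
    (hb : ∀ᵐ t, t ∈ Icc 0 T → ‖x t‖ ≤ δ → ‖g t‖ ≤ C) {t : ℝ} (ht : t ∈ Icc 0 T) :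
    ‖x t‖ ≤ δ := by
  by_contra! hlt
  have hcl : IsCompact (Icc 0 T ∩ (fun t => ‖x t‖) ⁻¹' Ici δ) :=
    isCompact_Icc.of_isClosed_subset
      (hxc.norm.preimage_isClosed_of_isClosed isClosed_Icc isClosed_Ici) inter_subset_left
  obtain ⟨t₀, ⟨ht₀, hδ⟩, hmin⟩ := hcl.exists_isLeast ⟨t, ht, hlt.le⟩
  have h1 : ‖∫ r in (0 : ℝ)..t₀, g r‖ ≤ C * |t₀ - 0| := by
    refine intervalIntegral.norm_integral_le_of_norm_le_const_ae ?_
    have hne : ∀ᵐ r : ℝ, r ≠ t₀ := by simp [ae_iff, measure_singleton]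
    filter_upwards [hb, hne] with r hr hne hmem
    rw [uIoc_of_le ht₀.1] at hmem
    have hr' : r ∈ Icc 0 T := ⟨hmem.1.le, hmem.2.trans ht₀.2⟩
    refine hr hr' ?_
    by_contra! hcon
    exact hne (le_antisymm hmem.2 (hmin ⟨hr', hcon.le⟩))
  have h2 : δ ≤ ‖x t₀‖ := hδ
  rw [hx t₀ ht₀, hx0, zero_add] at h2
  rw [sub_zero, abs_of_nonneg ht₀.1] at h1
  have := mul_le_mul_of_nonneg_left ht₀.2 hC
  linarith

theorem IsSolution.isTrajectory {n : ℕ} {f₀ f₁ f₂ : State n → State n}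
    {Q : State n →L[ℝ] State n} {φ : State n →L[ℝ] ℝ} {M C δ T : ℝ} {u : ℝ → Fin 2 → ℝ}
    {z : ℝ → State n} (h : IsSolution f₀ ![f₁, f₂] T u z)
    (hE : UniformEstimates f₀ f₁ f₂ Q φ M C δ) (hT : 0 ≤ T) (hC : 0 ≤ C) (hM : 0 ≤ M)
    (hCT : C * T < δ) (hu : MemLp u ∞ (volume.restrict (Icc 0 T))) (hz0 : z 0 = 0)
    (hu0 : ∀ᵐ t, t ∈ Icc 0 T → |u t 0| ≤ M) (hu1 : ∀ᵐ t, t ∈ Icc 0 T → |u t 1| ≤ M)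
    (hneg : ∀ᵐ t, t ∈ Icc 0 T → φ (lieBracket ℝ f₁ (lieBracket ℝ f₀ f₁) 0
      + u t 1 • lieBracket ℝ f₁ (lieBracket ℝ f₂ f₁) 0) ≤ -1 / 2) :
    IsTrajectory f₀ f₁ f₂ φ M (M + C) T (fun t => u t 1) (fun t => u t 0)
      (fun t => ∫ r in (0 : ℝ)..t, u r 0) z := by
  have h0 : (0 : ℝ) ∈ Icc 0 T := ⟨le_rfl, hT⟩
  have hgi := h.integrableOn
  have hge := h.eq_integral
  simp only [sum_control] at hgi hge
  have hgi' := (intervalIntegrable_iff_integrableOn_Icc_of_le hT).2 hgi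
  have hui : IntervalIntegrable (fun t => u t 0) volume 0 T := by
    rw [intervalIntegrable_iff_integrableOn_Icc_of_le hT]
    exact (ContinuousLinearMap.proj (R := ℝ) (φ := fun _ : Fin 2 => ℝ) 0).integrable_comp
      (hu.integrable (by simp))
  have hball : ∀ t ∈ Icc 0 T, ‖z t‖ ≤ δ := fun t ht => by
    refine norm_le_of_eq_integral hC hCT h.continuousOn hz0 hge ?_ ht
    filter_upwards [hu0, hu1] with t h1 h2 ht hz
    exact hE.velocity _ _ _ (h2 ht) (h1 ht) hz
  have lz := lipschitzOnWith_of_eq_integral hC hgi' hge (by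
    filter_upwards [hu0, hu1] with t h1 h2 ht
    exact hE.velocity _ _ _ (h2 ht) (h1 ht) (hball t ht))
  have hs : ∀ t ∈ Icc 0 T, (∫ r in (0 : ℝ)..t, u r 0) = (∫ r in (0 : ℝ)..0, u r 0)
      + ∫ r in (0 : ℝ)..t, u r 0 := fun t _ => by simp
  have ls := lipschitzOnWith_of_eq_integral hM hui hs hu0
  refine ⟨⟨_, ls⟩, ⟨_, lz⟩, by simp, hz0, fun t ht => ?_, hu1, hu0, hneg,
    ae_hasDerivAt_of_eq_integral hT hui hs, ae_hasDerivAt_of_eq_integral hT hgi' hge⟩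
  have b1 := ls.dist_le_mul t ht 0 h0
  have b2 := lz.dist_le_mul t ht 0 h0
  simp only [intervalIntegral.integral_same, dist_zero_right, Real.norm_eq_abs, hz0,
    Real.coe_toNNReal _ hM, Real.coe_toNNReal _ hC, abs_of_nonneg ht.1] at b1 b2
  have := mul_le_mul_of_nonneg_left ht.2 hC
  have := mul_le_mul_of_nonneg_left ht.2 hM
  linarith

theorem ae_le_of_supNorm_le {m : ℕ} {N : Seminorm ℝ (Fin m → ℝ)} {T r : ℝ} (hr : 0 ≤ r)
    {w : ℝ → Fin m → ℝ} (h : supNorm N T w ≤ ENNReal.ofReal r) :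
    ∀ᵐ t, t ∈ Icc 0 T → N (w t) ≤ r := by
  rw [← ae_restrict_iff' measurableSet_Icc]
  filter_upwards [ENNReal.ae_le_essSup (μ := volume.restrict (Icc 0 T))
    (fun t => ENNReal.ofReal (N (w t)))] with t ht
  exact (ENNReal.ofReal_le_ofReal_iff hr).1 (ht.trans h)

/-- Equivalence of norms on `ℝᵐ`, for the coordinates. -/
theorem exists_abs_le_mul_seminorm {m : ℕ} (N : Seminorm ℝ (Fin m → ℝ))
    (hN : ∀ v, N v = 0 → v = 0) : ∃ c : ℝ, 0 ≤ c ∧ ∀ v k, |v k| ≤ c * N v := by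
  have hcont : Continuous N := by
    rw [← continuousOn_univ]
    exact N.convexOn.continuousOn isOpen_univ
  by_cases hne : (Metric.sphere (0 : Fin m → ℝ) 1).Nonempty
  · obtain ⟨v₀, hv₀, hmin⟩ := (isCompact_sphere (0 : Fin m → ℝ) 1).exists_isMinOn hne
      hcont.continuousOn
    have hpos : 0 < N v₀ := lt_of_le_of_ne (apply_nonneg N v₀) fun h => by
      have := hN v₀ h.symm
      simp [this] at hv₀
    refine ⟨(N v₀)⁻¹, by positivity, fun v k => ?_⟩
    have hle : ‖v‖ ≤ (N v₀)⁻¹ * N v := by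
      rcases eq_or_ne v 0 with rfl | hv
      · simp
      · have hv' : 0 < ‖v‖ := norm_pos_iff.2 hv
        have h1 : N v₀ ≤ N (‖v‖⁻¹ • v) := hmin (by simp [norm_smul, hv'.ne'])
        rw [map_smul_eq_mul, norm_inv, norm_norm, inv_mul_eq_div, le_div_iff₀ hv'] at h1
        rw [inv_mul_eq_div, le_div_iff₀ hpos]
        linarith
    exact (norm_le_pi_norm v k).trans hle
  · refine ⟨0, le_rfl, fun v k => ?_⟩
    have : v = 0 := by
      by_contra hv
      exact hne ⟨‖v‖⁻¹ • v, by simp [norm_smul, hv]⟩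
    simp [this]

end Solutions

/-! ### The subspace `R₁(0)` -/

section Subspace

variable {n : ℕ} {f₀ f₁ f₂ : State n → State n}

theorem apply_zero_mem_R₁AtZero {k : ℕ} (hk : k ≤ 1) {V : State n → State n}
    (hV : IsBracket f₀ f₁ f₂ k V) : V 0 ∈ R₁AtZero f₀ f₁ f₂ :=
  ⟨V, Submodule.subset_span ⟨k, hk, hV⟩, rfl⟩

/-- At a zero of `g`, bracketing with `g` acts on values as `-Dg(0)`, so `R₁(0)` is
invariant under `Dg(0)`. -/
theorem fderiv_mem_R₁AtZero {g : State n → State n} (hg : IsBracket f₀ f₁ f₂ 0 g) (hg0 : g 0 = 0)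
    {x : State n} (hx : x ∈ R₁AtZero f₀ f₁ f₂) : fderiv ℝ g 0 x ∈ R₁AtZero f₀ f₁ f₂ := by
  obtain ⟨V, hV, rfl⟩ := hx
  induction hV using Submodule.span_induction with
  | mem V hV =>
    obtain ⟨k, hk, hV⟩ := hV
    have hm := apply_zero_mem_R₁AtZero (by simpa using hk) (hg.bracket hV)
    have e : lieBracket ℝ g V 0 = -fderiv ℝ g 0 (V 0) := by simp [lieBracket, hg0]
    rw [e] at hm
    exact neg_mem_iff.1 hm
  | zero => simp
  | add V W _ _ hV hW => simpa using add_mem hV hW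
  | smul a V _ hV => simpa using Submodule.smul_mem _ a hV

/-- The orthogonal projection `Q` along `P` kills `P`, and `L ∘ A` factors through `Q`
whenever `L` kills `P` and `A` preserves `P`. -/
theorem exists_factor (P : Submodule ℝ (State n)) :
    ∃ Q : State n →L[ℝ] State n, (∀ x ∈ P, Q x = 0) ∧
      ∀ {F : Type} [NormedAddCommGroup F] [NormedSpace ℝ F] (L : State n →L[ℝ] F)
        (A : State n →L[ℝ] State n), (∀ x ∈ P, L x = 0) → (∀ x ∈ P, A x ∈ P) →
        ∀ x, L (A x) = L (A (Q x)) := by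
  refine ⟨ContinuousLinearMap.id ℝ _ - P.starProjection, fun x hx => ?_,
    fun L A hL hA x => ?_⟩
  · simp [Submodule.starProjection_eq_self_iff.2 hx]
  · have := hL _ (hA _ (P.starProjection_apply_mem x))
    simp [this]

end Subspace

/-! ### Obstruction to controllability -/

section Obstruction

variable {n : ℕ} {f₀ f₁ f₂ : State n → State n}

/-- If a functional `φ` vanishing on `R₁(0)` is negative on `[f₁, [f₀ + v f₂, f₁]](0)` for all
admissible values `v` of the second control, then in small time some states near the origin
cannot be reached from the origin. -/
theorem eventually_exists_not_canSteer (hf₀ : ContDiff ℝ (⊤ : ℕ∞) f₀)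
    (hf₁ : ContDiff ℝ (⊤ : ℕ∞) f₁) (hf₂ : ContDiff ℝ (⊤ : ℕ∞) f₂) (h0 : f₀ 0 = 0)
    (h2 : f₂ 0 = 0) (h1 : f₁ 0 ≠ 0) {N : Seminorm ℝ (Fin 2 → ℝ)} {c u₂ ρ : ℝ} (hc : 0 ≤ c)
    (hN : ∀ v k, |v k| ≤ c * N v) (hρ : 0 ≤ ρ) {φ : State n →L[ℝ] ℝ}
    (hφ : ∀ x ∈ R₁AtZero f₀ f₁ f₂, φ x = 0)
    (hneg : ∀ v, |v - u₂| ≤ c * ρ → φ (lieBracket ℝ f₁ (lieBracket ℝ f₀ f₁) 0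
      + v • lieBracket ℝ f₁ (lieBracket ℝ f₂ f₁) 0) ≤ -1 / 2) :
    ∀ᶠ T : ℝ in 𝓝[>] 0, ∀ r, 0 ≤ r → r ≤ ρ → ∀ η > 0, ∃ z₁ ∈ Metric.ball (0 : State n) η,
      ¬ CanSteer f₀ ![f₁, f₂] N ![0, u₂] T r 0 z₁ := by
  obtain ⟨Q, hQ, hfac⟩ := exists_factor (R₁AtZero f₀ f₁ f₂)
  have hb : f₁ 0 ∈ R₁AtZero f₀ f₁ f₂ := apply_zero_mem_R₁AtZero le_rfl .base₁
  have inv₀ : ∀ x ∈ R₁AtZero f₀ f₁ f₂, fderiv ℝ f₀ 0 x ∈ R₁AtZero f₀ f₁ f₂ :=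
    fun x => fderiv_mem_R₁AtZero .base₀ h0
  have inv₂ : ∀ x ∈ R₁AtZero f₀ f₁ f₂, fderiv ℝ f₂ 0 x ∈ R₁AtZero f₀ f₁ f₂ :=
    fun x => fderiv_mem_R₁AtZero .base₂ h2
  set M := |u₂| + c * ρ with hM
  have hM0 : 0 ≤ M := by positivity
  obtain ⟨C, δ, hC, hδ, hE⟩ := exists_uniformEstimates hf₀ hf₁ hf₂ h0 h2 (hQ _ hb)
    (hfac Q _ hQ inv₀) (hfac Q _ hQ inv₂) (hfac φ _ hφ inv₀) (hfac φ _ hφ inv₂) hM0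
  have hC0 : 0 ≤ C := by linarith
  obtain ⟨D, hD, hev⟩ := IsTrajectory.eventually_nonneg (κ := M + C) hE hf₁ hC hδ (by positivity)
    h1 (hφ _ hb)
  filter_upwards [hev, eventually_mul_le C (half_pos hδ), eventually_mem_nhdsWithin]
    with T hT hCT hT0 r hr hrρ η hη
  -- a target on the negative side of `φ`, so close to the origin that quadratic terms are dominated
  set e := lieBracket ℝ f₁ (lieBracket ℝ f₀ f₁) 0
      + u₂ • lieBracket ℝ f₁ (lieBracket ℝ f₂ f₁) 0 with he
  have hφe : φ e ≤ -1 / 2 := hneg u₂ (by simpa using mul_nonneg hc hρ)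
  obtain ⟨τ, hτ0, hτη, hτD⟩ : ∃ τ : ℝ, 0 < τ ∧ ‖e‖ * τ ≤ η / 2 ∧ (D * ‖e‖ ^ 2) * τ ≤ 1 / 4 := by
    obtain ⟨τ, h⟩ := ((eventually_mem_nhdsWithin (a := (0 : ℝ)) (s := Ioi 0)).and
      ((eventually_mul_le ‖e‖ (half_pos hη)).and
        (eventually_mul_le (D * ‖e‖ ^ 2) (by norm_num : (0 : ℝ) < 1 / 4)))).exists
    exact ⟨τ, h.1, h.2.1, h.2.2⟩
  refine ⟨τ • e, ?_, ?_⟩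
  · rw [mem_ball_zero_iff, norm_smul, Real.norm_of_nonneg hτ0.le]
    linarith
  rintro ⟨u, z, hu, hsol, hz0, hzT, hsup⟩
  have hsup' := ae_le_of_supNorm_le hr hsup
  have hle : ∀ᵐ t, t ∈ Icc 0 T → ∀ k, |u t k - (![0, u₂] : Fin 2 → ℝ) k| ≤ c * ρ := by
    filter_upwards [hsup'] with t ht hmem k
    exact (hN _ k).trans (mul_le_mul_of_nonneg_left ((ht hmem).trans hrρ) hc)
  have hcρ : 0 ≤ c * ρ := mul_nonneg hc hρ
  have htraj := hsol.isTrajectory hE (le_of_lt hT0) hC0 hM0 (by linarith) hu hz0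
    (by
      filter_upwards [hle] with t ht hmem
      have := ht hmem 0
      simp only [Matrix.cons_val_zero, sub_zero] at this
      linarith [abs_nonneg u₂])
    (by
      filter_upwards [hle] with t ht hmem
      have := ht hmem 1
      simp only [Matrix.cons_val_one, Matrix.cons_val_fin_one] at this
      have h3 := abs_add_le u₂ (u t 1 - u₂)
      rw [add_sub_cancel] at h3
      linarith)
    (by
      filter_upwards [hle] with t ht hmem
      exact hneg _ (by simpa using ht hmem 1))
  have := hT _ _ _ _ htraj
  rw [hzT, map_smul, norm_smul, Real.norm_of_nonneg hτ0.le, smul_eq_mul, mul_pow] at this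
  have i1 := mul_le_mul_of_nonneg_left hφe hτ0.le
  have i2 := mul_le_mul_of_nonneg_left hτD hτ0.le
  have : D * (τ ^ 2 * ‖e‖ ^ 2) = τ * (D * ‖e‖ ^ 2 * τ) := by ring
  linarith

/-- A functional vanishing on a subspace `P` and equal to `-1` at a given vector outside `P`. -/
theorem exists_functional {P : Submodule ℝ (State n)} {e : State n} (he : e ∉ P) :
    ∃ φ : State n →L[ℝ] ℝ, (∀ x ∈ P, φ x = 0) ∧ φ e = -1 := by
  obtain ⟨g, hg, hP⟩ := Submodule.exists_le_ker_of_notMem he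
  refine ⟨LinearMap.toContinuousLinearMap (-(g e)⁻¹ • g), fun x hx => ?_, ?_⟩
  · simp [LinearMap.mem_ker.1 (hP hx)]
  · simp [hg]

end Obstruction
end ControlAffine

open ControlAffine Filter Topology

theorem theorem1 {n : ℕ}
    (f₀ f₁ f₂ : ControlAffine.State n → ControlAffine.State n)
    (hf₀ : AnalyticOnNhd ℝ f₀ Set.univ)
    (hf₁ : AnalyticOnNhd ℝ f₁ Set.univ)
    (hf₂ : AnalyticOnNhd ℝ f₂ Set.univ)
    (hf₀_zero : f₀ 0 = 0) (hf₂_zero : f₂ 0 = 0) (hf₁_zero : f₁ 0 ≠ 0)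
    -- an arbitrary norm on the space of control values
    (N : Seminorm ℝ (Fin 2 → ℝ)) (hN : ∀ v, N v = 0 → v = 0)
    (hB₁ : lieBracket ℝ f₁ (lieBracket ℝ f₀ f₁) 0 ∉ ControlAffine.R₁AtZero f₀ f₁ f₂) :
    (∀ β : ℝ,
      lieBracket ℝ f₁ (lieBracket ℝ f₀ f₁) 0 + β • lieBracket ℝ f₁ (lieBracket ℝ f₂ f₁) 0
          ∈ ControlAffine.R₁AtZero f₀ f₁ f₂ →
        ∀ u₂eq : ℝ, u₂eq ≠ β → ¬ ControlAffine.STLC f₀ ![f₁, f₂] N 0 ![0, u₂eq]) ∧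
    (lieBracket ℝ f₁ (lieBracket ℝ f₀ f₁) 0 ∉
        ControlAffine.R₁AtZero f₀ f₁ f₂ ⊔
          Submodule.span ℝ {lieBracket ℝ f₁ (lieBracket ℝ f₂ f₁) 0} →
      ∀ u₂eq α : ℝ, 0 ≤ α → ¬ ControlAffine.AlphaSTLC f₀ ![f₁, f₂] N α 0 ![0, u₂eq]) := by
  have c₀ : ContDiff ℝ (⊤ : ℕ∞) f₀ := hf₀.contDiff
  have c₁ : ContDiff ℝ (⊤ : ℕ∞) f₁ := hf₁.contDiff
  have c₂ : ContDiff ℝ (⊤ : ℕ∞) f₂ := hf₂.contDiff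
  obtain ⟨c, hc, hcN⟩ := exists_abs_le_mul_seminorm N hN
  set B := lieBracket ℝ f₁ (lieBracket ℝ f₀ f₁) 0
  set B' := lieBracket ℝ f₁ (lieBracket ℝ f₂ f₁) 0 with hB'
  set P := R₁AtZero f₀ f₁ f₂
  have shift : ∀ u₂eq v : ℝ, B + v • B' = (B + u₂eq • B') + (v - u₂eq) • B' := fun u₂eq v => by
    module
  refine ⟨fun β hβ u₂eq hne hctrl => ?_, fun hB u₂eq α hα hctrl => ?_⟩
  · have he : B + u₂eq • B' ∉ P := fun hmem => by
      have h3 : (u₂eq - β) • B' ∈ P := by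
        have := P.sub_mem hmem hβ
        rwa [add_sub_add_left_eq_sub, ← sub_smul] at this
      have h4 : B' ∈ P := (P.smul_mem_iff (sub_ne_zero.2 hne)).1 h3
      exact hB₁ ((P.add_mem_iff_left (P.smul_mem β h4)).1 hβ)
    obtain ⟨φ, hφ, hφe⟩ := exists_functional he
    -- radius of second controls around `u₂eq` on which `φ` stays below `-1/2`
    obtain ⟨ρ, hρ0, hρ⟩ := ((eventually_mem_nhdsWithin (a := (0 : ℝ)) (s := Set.Ioi 0)).and
      (eventually_mul_le (c * |φ B'|) (by norm_num : (0 : ℝ) < 1 / 2))).exists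
    have hρ0 : 0 < ρ := hρ0
    have hev := eventually_exists_not_canSteer c₀ c₁ c₂ hf₀_zero hf₂_zero hf₁_zero hc hcN
      hρ0.le hφ (u₂ := u₂eq) fun v hv => by
        change φ (B + v • B') ≤ -1 / 2
        rw [shift u₂eq v, map_add, map_smul, hφe, smul_eq_mul]
        have h5 : (v - u₂eq) * φ B' ≤ c * ρ * |φ B'| :=
          (le_abs_self _).trans (by rw [abs_mul]; gcongr)
        linarith
    obtain ⟨T, hT, hT0, hTρ⟩ := (hev.and (eventually_mem_nhdsWithin.and
      (eventually_mul_le 1 hρ0))).exists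
    have hT0 : 0 < T := hT0
    obtain ⟨η, hη, hη'⟩ := hctrl T hT0
    obtain ⟨z₁, hz₁, hnot⟩ := hT T hT0.le (by simpa using hTρ) η hη
    exact hnot (hη' 0 (Metric.mem_ball_self hη) z₁ hz₁)
  · have hB'mem : B' ∈ P ⊔ Submodule.span ℝ {B'} :=
      Submodule.mem_sup_right (Submodule.mem_span_singleton_self B')
    have he : B + u₂eq • B' ∉ P ⊔ Submodule.span ℝ {B'} := fun hmem =>
      hB ((Submodule.add_mem_iff_left _ (Submodule.smul_mem _ u₂eq hB'mem)).1 hmem)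
    obtain ⟨φ, hφ, hφe⟩ := exists_functional he
    have hev := eventually_exists_not_canSteer c₀ c₁ c₂ hf₀_zero hf₂_zero hf₁_zero hc hcN
      (by positivity : 0 ≤ α + 1) (fun x hx => hφ x (Submodule.mem_sup_left hx)) (u₂ := u₂eq)
      fun v _ => by
        change φ (B + v • B') ≤ -1 / 2
        rw [shift u₂eq v, map_add, map_smul, hφe, hφ B' hB'mem]
        norm_num
    obtain ⟨T, hT, hT0, hT1⟩ := (hev.and (eventually_mem_nhdsWithin.and
      (eventually_mul_le 1 one_pos))).exists
    have hT0 : 0 < T := hT0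
    obtain ⟨η, hη, hη'⟩ := hctrl T hT0
    obtain ⟨z₁, hz₁, hnot⟩ := hT (α + T) (by positivity) (by linarith) η hη
    exact hnot (hη' 0 (Metric.mem_ball_self hη) z₁ hz₁)
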